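/- Let $Q$ be a finite-dimensional, paracompact, Hausdorff real analytic manifold with tangent bundle $\tau\colon TQ\to Q$, let $\nabla$ be an analytic affine connection on $Q$ (torsion is allowed), and let $\mathscr{Y}=\{Y_1,\dots,Y_r\}$ be a finite family of analytic vector fields on $Q$. Let $\mathrm{Sym}^{(\infty)}(\mathscr{Y})$ be the smallest real vector space of vector fields on $Q$ that contains $\mathscr{Y}$ and is closed under the symmetric product $\langle X:Y\rangle=\nabla_XY+\nabla_YX$. For a set $S$ of vector fields on a manifold, let $\mathrm{Lie}^{(\infty)}(S)$ be the smallest real vector space of vector fields that contains $S$ and is closed under the Lie bracket. For such a space $L$ of vector fields, a subscript denotes values, $L_x=\{X(x): X\in L\}$, and $L$ is regarded as the (possibly singular) distribution $x\mapsto L_x$. For $v_q\in T_qQ$, let $V_{v_q}(TQ)=\ker T_{v_q}\tau$ be the vertical subspace, let $\mathrm{vlft}_{v_q}\colon T_qQ\to T_{v_q}TQ$, $\mathrm{vlft}_{v_q}(u)=\frac{d}{dt}\big|_{t=0}(v_q+tu)$, be the vertical lift, let $H_{v_q}(TQ)$ be the horizontal subspace of $\nabla$, and let $\mathrm{hlft}_{v_q}=(T_{v_q}\tau|_{H_{v_q}(TQ)})^{-1}\colon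 T_qQ\to H_{v_q}(TQ)$ be the horizontal lift. Let $Z$ be the geodesic spray, $Z(v_q)=\mathrm{hlft}_{v_q}(v_q)$, and let $Y_a^V(v_q)=\mathrm{vlft}_{v_q}(Y_a(q))$; put $\mathscr{Y}^V=\{Y_1^V,\dots,Y_r^V\}$ and $\mathrm{Lie}^{(\infty)}(Z,\mathscr{Y}^V)=\mathrm{Lie}^{(\infty)}(\{Z\}\cup\mathscr{Y}^V)$, a space of vector fields on $TQ$. Suppose that $\nabla$ restricts to $\mathrm{Sym}^{(\infty)}(\mathscr{Y})$, that is: if $X,Y$ are analytic vector fields on $Q$ with $Y(p)\in\mathrm{Sym}^{(\infty)}(\mathscr{Y})_p$ for all $p\in Q$, then $(\nabla_XY)(p)\in\mathrm{Sym}^{(\infty)}(\mathscr{Y})_p$ for all $p\in Q$. Then for every $q\in Q$ and every $v_q\in\mathrm{Sym}^{(\infty)}(\mathscr{Y})_q$: 1. the vertical lift $\mathrm{vlft}_{v_q}$ restricts to a linear isomorphism $$\mathrm{Sym}^{(\infty)}(\mathscr{Y})_q\;\cong\;\mathrm{Lie}^{(\infty)}(Z,\mathscr{Y}^V)_{v_q}\cap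 V_{v_q}(TQ);$$ 2. under the identification $\mathrm{hlft}_{v_q}\colon T_qQ\cong H_{v_q}(TQ)$, $$\mathrm{hlft}_{v_q}\big(\mathrm{Lie}^{(\infty)}(\mathrm{Sym}^{(\infty)}(\mathscr{Y}))_q\big)\;\subseteq\;\mathrm{Lie}^{(\infty)}(Z,\mathscr{Y}^V)_{v_q}\cap H_{v_q}(TQ).$$ -/

import Mathlib

open scoped Manifold ContDiff Topology
open Bundle

noncomputable section

namespace AffineControl

section VectorFields

variable {E : Type*} [NormedAddCommGroup E] [NormedSpace ℝ E]
  {H : Type*} [TopologicalSpace H] (I : ModelWithCorners ℝ E H)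
  {M : Type*} [TopologicalSpace M] [ChartedSpace H M]

/-- `X` is an analytic vector field: an analytic section of the tangent bundle. -/
def IsAnalyticField [IsManifold I 1 M] (X : Π x : M, TangentSpace I x) : Prop :=
  ContMDiff I I.tangent ω (fun x ↦ (⟨x, X x⟩ : TangentBundle I M))

/-- The involutive closure `Lie^(∞)(S)` of a set `S` of vector fields: the smallest real vector
space of vector fields containing `S` and closed under the Lie bracket. -/
def lieClosure (S : Set (Π x : M, TangentSpace I x)) :
    Submodule ℝ (Π x : M, TangentSpace I x) :=
  sInf {L | S ⊆ L ∧ ∀ X ∈ L, ∀ Y ∈ L, VectorField.mlieBracket I X Y ∈ L}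

variable {I}

/-- The (possibly singular) distribution spanned by a vector space `L` of vector fields: its fibre
`L_x` at `x` consists of the values at `x` of the members of `L`. -/
def valuesAt (L : Submodule ℝ (Π x : M, TangentSpace I x)) (x : M) :
    Submodule ℝ (TangentSpace I x) :=
  L.map (LinearMap.proj x)

end VectorFields

variable {E : Type*} [NormedAddCommGroup E] [NormedSpace ℝ E]
  {Q : Type*} [TopologicalSpace Q] [ChartedSpace E Q] [IsManifold 𝓘(ℝ, E) ω Q]

/-- An affine connection `nabla` (with `nabla Y q (X q) = (∇_X Y)(q)`) is analytic if `∇Y` is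
analytic on every open set on which the vector field `Y` is analytic. -/
def IsAnalyticConnection
    (nabla : CovariantDerivative 𝓘(ℝ, E) E (TangentSpace 𝓘(ℝ, E) : Q → Type _)) : Prop :=
  ∀ u : Set Q, IsOpen u → ContMDiffCovariantDerivativeOn E ω nabla.toFun u

/-- The symmetric product `⟨X : Y⟩ = ∇_X Y + ∇_Y X`. -/
def symProduct (nabla : CovariantDerivative 𝓘(ℝ, E) E (TangentSpace 𝓘(ℝ, E) : Q → Type _))
    (X Y : Π q : Q, TangentSpace 𝓘(ℝ, E) q) : Π q : Q, TangentSpace 𝓘(ℝ, E) q :=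
  fun q ↦ nabla Y q (X q) + nabla X q (Y q)

/-- The symmetric closure `Sym^(∞)(S)`: the smallest real vector space of vector fields containing
`S` and closed under the symmetric product. -/
def symClosure (nabla : CovariantDerivative 𝓘(ℝ, E) E (TangentSpace 𝓘(ℝ, E) : Q → Type _))
    (S : Set (Π q : Q, TangentSpace 𝓘(ℝ, E) q)) :
    Submodule ℝ (Π q : Q, TangentSpace 𝓘(ℝ, E) q) :=
  sInf {L | S ⊆ L ∧ ∀ X ∈ L, ∀ Y ∈ L, symProduct nabla X Y ∈ L}

/-- `∇` restricts to the distribution `D`: for every analytic vector field `X` and every analytic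
section `Y` of `D`, the vector field `∇_X Y` is a section of `D`. -/
def RestrictsTo (nabla : CovariantDerivative 𝓘(ℝ, E) E (TangentSpace 𝓘(ℝ, E) : Q → Type _))
    (D : Π q : Q, Submodule ℝ (TangentSpace 𝓘(ℝ, E) q)) : Prop :=
  ∀ X Y : Π q : Q, TangentSpace 𝓘(ℝ, E) q,
    IsAnalyticField 𝓘(ℝ, E) X → IsAnalyticField 𝓘(ℝ, E) Y → (∀ q, Y q ∈ D q) →
      ∀ q, nabla Y q (X q) ∈ D q

/-- The tangent map `T_v τ : T_v TQ → T_q Q` of the projection `τ : TQ → Q` at `v ∈ T_q Q`. -/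
def tangentProj (v : TangentBundle 𝓘(ℝ, E) Q) :
    TangentSpace 𝓘(ℝ, E).tangent v →L[ℝ] TangentSpace 𝓘(ℝ, E) v.1 :=
  mfderiv 𝓘(ℝ, E).tangent 𝓘(ℝ, E) (fun w : TangentBundle 𝓘(ℝ, E) Q ↦ w.1) v

/-- The vertical subspace `V_v(TQ) = ker T_v τ`. -/
def verticalSpace (v : TangentBundle 𝓘(ℝ, E) Q) :
    Submodule ℝ (TangentSpace 𝓘(ℝ, E).tangent v) :=
  (tangentProj v).ker

/-- The vertical lift `vlft_v : T_q Q → T_v TQ` at `v ∈ T_q Q`: the derivative at `v` of the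
inclusion of the fibre `T_q Q` (modelled on `E`) into `TQ`. Thus `vlft_v u` is the velocity at
`t = 0` of `t ↦ v + t u`, see `verticalLift_eq_velocity`. -/
def verticalLift (v : TangentBundle 𝓘(ℝ, E) Q) :
    TangentSpace 𝓘(ℝ, E) v.1 →L[ℝ] TangentSpace 𝓘(ℝ, E).tangent v :=
  mfderiv 𝓘(ℝ, E) 𝓘(ℝ, E).tangent (fun w : E ↦ (⟨v.1, w⟩ : TangentBundle 𝓘(ℝ, E) Q)) v.2

/-- The horizontal lift `hlft_v : T_q Q → T_v TQ` at `v ∈ T_q Q`. If `σ` is a local vector field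
with `σ(q) = v`, then `hlft_v u = T_q σ (u) - vlft_v (∇_u σ)`; here `σ` is the field that has
constant components in the preferred chart at `q`, so that in this chart
`hlft_v u = u^i (∂/∂q^i - Γ^j_{ik} v^k ∂/∂v^j)`. Any other `σ` gives the same,
see `horizontalLift_eq`. -/
def horizontalLift (nabla : CovariantDerivative 𝓘(ℝ, E) E (TangentSpace 𝓘(ℝ, E) : Q → Type _))
    (v : TangentBundle 𝓘(ℝ, E) Q) :
    TangentSpace 𝓘(ℝ, E) v.1 →L[ℝ] TangentSpace 𝓘(ℝ, E).tangent v :=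
  letI σ : Π q : Q, TangentSpace 𝓘(ℝ, E) q := FiberBundle.extend E v.2
  letI dσ : TangentSpace 𝓘(ℝ, E) v.1 →L[ℝ] TangentSpace 𝓘(ℝ, E).tangent v :=
    mfderiv 𝓘(ℝ, E) 𝓘(ℝ, E).tangent (fun q ↦ (⟨q, σ q⟩ : TangentBundle 𝓘(ℝ, E) Q)) v.1
  dσ - (verticalLift v).comp (nabla σ v.1)

/-- The horizontal subspace `H_v(TQ)` of the connection. -/
def horizontalSpace (nabla : CovariantDerivative 𝓘(ℝ, E) E (TangentSpace 𝓘(ℝ, E) : Q → Type _))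
    (v : TangentBundle 𝓘(ℝ, E) Q) : Submodule ℝ (TangentSpace 𝓘(ℝ, E).tangent v) :=
  (horizontalLift nabla v).range

/-- The geodesic spray `Z` of the connection: `Z(v) = hlft_v v`. In coordinates,
`Z = v^i ∂/∂q^i - Γ^j_{ik} v^i v^k ∂/∂v^j`. -/
def geodesicSpray (nabla : CovariantDerivative 𝓘(ℝ, E) E (TangentSpace 𝓘(ℝ, E) : Q → Type _)) :
    Π v : TangentBundle 𝓘(ℝ, E) Q, TangentSpace 𝓘(ℝ, E).tangent v :=
  fun v ↦ horizontalLift nabla v v.2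

/-- The vertical lift `X^V` of a vector field `X` on `Q`, a vector field on `TQ`. -/
def verticalLiftField (X : Π q : Q, TangentSpace 𝓘(ℝ, E) q) :
    Π v : TangentBundle 𝓘(ℝ, E) Q, TangentSpace 𝓘(ℝ, E).tangent v :=
  fun v ↦ verticalLift v (X v.1)

/-- The vector space `Lie^(∞)(Z, S^V)` of vector fields on `TQ`. -/
def accessibilityAlgebra
    (nabla : CovariantDerivative 𝓘(ℝ, E) E (TangentSpace 𝓘(ℝ, E) : Q → Type _))
    (S : Set (Π q : Q, TangentSpace 𝓘(ℝ, E) q)) :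
    Submodule ℝ (Π v : TangentBundle 𝓘(ℝ, E) Q, TangentSpace 𝓘(ℝ, E).tangent v) :=
  lieClosure 𝓘(ℝ, E).tangent (insert (geodesicSpray nabla) (verticalLiftField '' S))


/-! ### The lifts and the splitting are the usual ones -/

theorem mfderiv_into_tangentBundle
    {N : Type*} [NormedAddCommGroup N] [NormedSpace ℝ N] {M : Type*} [TopologicalSpace M]
    [ChartedSpace N M] {f : M → TangentBundle 𝓘(ℝ, E) Q} {x : M}
    (hf : MDifferentiableAt 𝓘(ℝ, N) 𝓘(ℝ, E).tangent f x) :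
    (mfderiv 𝓘(ℝ, N) 𝓘(ℝ, E).tangent f x : N →L[ℝ] E × E) =
      ContinuousLinearMap.prod (mfderiv 𝓘(ℝ, N) 𝓘(ℝ, E) (fun y ↦ (f y).1) x : N →L[ℝ] E)
       (mfderiv 𝓘(ℝ, N) 𝓘(ℝ, E)
          (fun y ↦ (trivializationAt E (TangentSpace 𝓘(ℝ, E)) (f x).1 (f y)).2) x : N →L[ℝ] E) := by
  obtain ⟨h1, h2⟩ := (mdifferentiableAt_totalSpace 𝓘(ℝ, E) f).1 hf
  have h := (h1.hasMFDerivAt.prodMk h2.hasMFDerivAt)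
  have key : HasMFDerivAt 𝓘(ℝ, N) 𝓘(ℝ, E).tangent f x
      (ContinuousLinearMap.prod (mfderiv 𝓘(ℝ, N) 𝓘(ℝ, E) (fun y ↦ (f y).1) x : N →L[ℝ] E)
       (mfderiv 𝓘(ℝ, N) 𝓘(ℝ, E)
          (fun y ↦ (trivializationAt E (TangentSpace 𝓘(ℝ, E)) (f x).1 (f y)).2) x :
            N →L[ℝ] E)) := by
    refine ⟨hf.continuousAt, ?_⟩
    refine h.2.congr_of_eventuallyEq ?_ ?_
    · simp only [writtenInExtChartAt, FiberBundle.extChartAt, Function.comp_def]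
      simp
      rfl
    · simp only [writtenInExtChartAt, FiberBundle.extChartAt, Function.comp_def]
      simp
      rfl
  exact key.mfderiv

theorem trivializationAt_self (q : Q) (w : E) :
    (trivializationAt E (TangentSpace 𝓘(ℝ, E)) q (⟨q, w⟩ : TangentBundle 𝓘(ℝ, E) Q)).2 = w :=
  (tangentBundleCore 𝓘(ℝ, E) Q).coordChange_self (achart E q) q (mem_chart_source E q) w

theorem mdifferentiableAt_fibreInclusion (q : Q) (w : E) :
    MDifferentiableAt 𝓘(ℝ, E) 𝓘(ℝ, E).tangent
      (fun w : E ↦ (⟨q, w⟩ : TangentBundle 𝓘(ℝ, E) Q)) w := by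
  refine (mdifferentiableAt_totalSpace 𝓘(ℝ, E) _).2 ⟨mdifferentiableAt_const, ?_⟩
  simp only [trivializationAt_self]
  exact mdifferentiableAt_id

theorem verticalLift_apply (v : TangentBundle 𝓘(ℝ, E) Q) (u : TangentSpace 𝓘(ℝ, E) v.1) :
    verticalLift v u = ((0, u) : E × E) := by
  have h := mfderiv_into_tangentBundle (mdifferentiableAt_fibreInclusion (E := E) v.1 v.2)
  have e1 : (fun y : E ↦ (trivializationAt E (TangentSpace 𝓘(ℝ, E)) v.1
      (⟨v.1, y⟩ : TangentBundle 𝓘(ℝ, E) Q)).2) = id := funext fun y ↦ trivializationAt_self v.1 y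
  refine (congrArg (fun L : E →L[ℝ] E × E ↦ L u) h).trans ?_
  refine Prod.ext ?_ ?_
  · exact congrArg (fun L : E →L[ℝ] E ↦ L u)
      (mfderiv_const (M := E) (I := 𝓘(ℝ, E)) (I' := 𝓘(ℝ, E)) (c := v.1) (x := v.2))
  · refine (congrArg (fun g : E → E ↦ (mfderiv 𝓘(ℝ, E) 𝓘(ℝ, E) g v.2 : E →L[ℝ] E) u) e1).trans ?_
    exact congrArg (fun L : E →L[ℝ] E ↦ L u) (mfderiv_id (M := E) (I := 𝓘(ℝ, E)) (x := v.2))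

/-- `vlft_v u` is the velocity at `t = 0` of the curve `t ↦ v + t u`. -/
theorem verticalLift_eq_velocity (v : TangentBundle 𝓘(ℝ, E) Q) (u : TangentSpace 𝓘(ℝ, E) v.1) :
    (verticalLift v u : E × E) = mfderiv 𝓘(ℝ, ℝ) 𝓘(ℝ, E).tangent
      (fun t : ℝ ↦ (⟨v.1, v.2 + t • u⟩ : TangentBundle 𝓘(ℝ, E) Q)) 0 (1 : ℝ) := by
  obtain ⟨q, w⟩ := v
  change E at w u
  let c : ℝ → E := fun t ↦ w + t • u
  have hc : HasFDerivAt c ((ContinuousLinearMap.id ℝ ℝ).smulRight u) 0 :=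
    ((ContinuousLinearMap.id ℝ ℝ).smulRight u).hasFDerivAt.const_add w
  have h0 : c 0 = w := by simp [c]
  have hv := (mdifferentiableAt_fibreInclusion (E := E) q (c 0)).hasMFDerivAt
  have h1 := (hv.comp (0 : ℝ) hc.hasMFDerivAt).mfderiv
  refine Eq.trans ?_ (congrArg (fun L : ℝ →L[ℝ] E × E ↦ L 1) h1).symm
  rw [h0]
  change _ = (verticalLift (⟨q, w⟩ : TangentBundle 𝓘(ℝ, E) Q) ((1 : ℝ) • u) : E × E)
  rw [one_smul]

/-- `hlft_{σ(q)} u = T_q σ (u) - vlft (∇_u σ)` for every vector field `σ` that is differentiable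
at `q`. -/
theorem horizontalLift_eq [FiniteDimensional ℝ E]
    (nabla : CovariantDerivative 𝓘(ℝ, E) E (TangentSpace 𝓘(ℝ, E) : Q → Type _))
    (q : Q) (σ : Π q : Q, TangentSpace 𝓘(ℝ, E) q)
    (hσ : MDifferentiableAt 𝓘(ℝ, E) 𝓘(ℝ, E).tangent
      (fun q ↦ (⟨q, σ q⟩ : TangentBundle 𝓘(ℝ, E) Q)) q) (u : TangentSpace 𝓘(ℝ, E) q) :
    horizontalLift nabla ⟨q, σ q⟩ u =
      (mfderiv 𝓘(ℝ, E) 𝓘(ℝ, E).tangent (fun q ↦ (⟨q, σ q⟩ : TangentBundle 𝓘(ℝ, E) Q)) q u :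
        TangentSpace 𝓘(ℝ, E).tangent (⟨q, σ q⟩ : TangentBundle 𝓘(ℝ, E) Q)) -
        verticalLift ⟨q, σ q⟩ (nabla σ q u) := by
  let t := trivializationAt E (TangentSpace 𝓘(ℝ, E)) q
  let c : (Π q : Q, TangentSpace 𝓘(ℝ, E) q) → Q → E := fun σ y ↦ t.continuousLinearMapAt ℝ y (σ y)
  let n : (Π q : Q, TangentSpace 𝓘(ℝ, E) q) → E := fun σ ↦ nabla σ q u
  have hc (σ) : c σ =ᶠ[𝓝 q] fun y ↦ (t ⟨y, σ y⟩).2 := by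
    filter_upwards [t.open_baseSet.mem_nhds (FiberBundle.mem_baseSet_trivializationAt' q)]
      with y hy
    exact t.continuousLinearMapAt_apply_of_mem ℝ hy (σ y)
  have hq (σ : Π q : Q, TangentSpace 𝓘(ℝ, E) q) : c σ q = (show E from σ q) :=
    (hc σ).self_of_nhds.trans (trivializationAt_self (E := E) q (σ q))
  have hd (σ) (hσ : MDifferentiableAt 𝓘(ℝ, E) 𝓘(ℝ, E).tangent
      (fun q ↦ (⟨q, σ q⟩ : TangentBundle 𝓘(ℝ, E) Q)) q) :
      MDifferentiableAt 𝓘(ℝ, E) 𝓘(ℝ, E) (c σ) q :=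
    ((mdifferentiableAt_section 𝓘(ℝ, E) σ).1 hσ).congr_of_eventuallyEq (hc σ)
  have hD (σ) (hσ : MDifferentiableAt 𝓘(ℝ, E) 𝓘(ℝ, E).tangent
      (fun q ↦ (⟨q, σ q⟩ : TangentBundle 𝓘(ℝ, E) Q)) q) :
      (mfderiv 𝓘(ℝ, E) 𝓘(ℝ, E).tangent (fun q ↦ (⟨q, σ q⟩ : TangentBundle 𝓘(ℝ, E) Q)) q u)
        = ((u, mvfderiv 𝓘(ℝ, E) (c σ) q u) : E × E) := by
    have h := mfderiv_into_tangentBundle hσ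
    refine (congrArg (fun L : E →L[ℝ] E × E ↦ L u) h).trans ?_
    have h1 : mfderiv 𝓘(ℝ, E) 𝓘(ℝ, E) (fun y : Q ↦ y) q = ContinuousLinearMap.id ℝ _ := mfderiv_id
    have h2 := (hc σ).mfderiv_eq (I := 𝓘(ℝ, E)) (I' := 𝓘(ℝ, E))
    refine Prod.ext ?_ ?_
    · exact congrArg (fun L : E →L[ℝ] E ↦ L u) h1
    · exact congrArg (fun L : E →L[ℝ] E ↦ L u) h2.symm
  have T : TensorialAt 𝓘(ℝ, E) E (fun σ : (Π q : Q, TangentSpace 𝓘(ℝ, E) q) ↦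
     n σ - mvfderiv 𝓘(ℝ, E) (c σ) q u) q := by
    constructor
    · intro f σ hf hσ
      have h1 : c (f • σ) = f • c σ := by
        funext y
        exact map_smul (t.continuousLinearMapAt ℝ y) (f y) (σ y)
      have h2 : n (f • σ) = f q • n σ + (mvfderiv 𝓘(ℝ, E) f q u) • c σ q := by
        rw [hq]
        exact congrArg (fun L : TangentSpace 𝓘(ℝ, E) q →L[ℝ] TangentSpace 𝓘(ℝ, E) q ↦ L u)
          (nabla.isCovariantDerivativeOnUniv.leibniz hσ hf)
      have h3 : mvfderiv 𝓘(ℝ, E) (c (f • σ)) q u =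
          f q • mvfderiv 𝓘(ℝ, E) (c σ) q u + (mvfderiv 𝓘(ℝ, E) f q u) • c σ q := by
        rw [h1, mvfderiv_smul hf (hd σ hσ)]; rfl
      rw [h2, h3, smul_sub]; abel
    · intro σ τ hσ hτ
      have h1 : c (σ + τ) = c σ + c τ := by
        funext y
        exact map_add (t.continuousLinearMapAt ℝ y) (σ y) (τ y)
      have h2 : n (σ + τ) = n σ + n τ :=
        congrArg (fun L : TangentSpace 𝓘(ℝ, E) q →L[ℝ] TangentSpace 𝓘(ℝ, E) q ↦ L u)
          (nabla.isCovariantDerivativeOnUniv.add hσ hτ)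
      have h3 : mvfderiv 𝓘(ℝ, E) (c (σ + τ)) q u =
          mvfderiv 𝓘(ℝ, E) (c σ) q u + mvfderiv 𝓘(ℝ, E) (c τ) q u := by
        rw [h1, mvfderiv_add (hd σ hσ) (hd τ hτ)]; rfl
      rw [h2, h3]; abel
  have hext := FiberBundle.mdifferentiableAt_extend 𝓘(ℝ, E) E (σ q)
  have hT := T.pointwise hext hσ (by simp)
  let X := FiberBundle.extend E (σ q)
  have a1 := hD X hext
  have a2 := hD σ hσ
  have b1 := verticalLift_apply ⟨q, σ q⟩ (nabla X q u)
  have b2 := verticalLift_apply ⟨q, σ q⟩ (nabla σ q u)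
  have e1 : horizontalLift nabla ⟨q, σ q⟩ u =
      ((u, mvfderiv 𝓘(ℝ, E) (c X) q u) : E × E) - ((0, n X) : E × E) := 
    congrArg₂ (fun a b : E × E ↦ a - b) a1 b1
  refine e1.trans (Eq.trans ?_ (congrArg₂ (fun a b : E × E ↦ a - b) a2 b2).symm)
  refine Prod.ext rfl ?_
  change mvfderiv 𝓘(ℝ, E) (c X) q u - n X = mvfderiv 𝓘(ℝ, E) (c σ) q u - n σ
  rw [← neg_sub, ← neg_sub (n σ)]
  exact congrArg Neg.neg hT

theorem tangentProj_verticalLift (v : TangentBundle 𝓘(ℝ, E) Q) (u : TangentSpace 𝓘(ℝ, E) v.1) :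
    tangentProj v (verticalLift v u) = 0 := by
  have hp := (mdifferentiableAt_proj (TangentSpace 𝓘(ℝ, E)) (p := v) (IB := 𝓘(ℝ, E))).hasMFDerivAt
  have h := (HasMFDerivAt.comp (M := E) v.2 hp
    (mdifferentiableAt_fibreInclusion (E := E) v.1 v.2).hasMFDerivAt).mfderiv
  refine (congrArg (fun L : E →L[ℝ] E ↦ L u) h).symm.trans ?_
  exact congrArg (fun L : E →L[ℝ] E ↦ L u)
      (mfderiv_const (M := E) (I := 𝓘(ℝ, E)) (I' := 𝓘(ℝ, E)) (c := v.1) (x := v.2))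

/-- `hlft_v` is inverse to the restriction of `T_v τ` to the horizontal subspace. -/
theorem tangentProj_horizontalLift
    (nabla : CovariantDerivative 𝓘(ℝ, E) E (TangentSpace 𝓘(ℝ, E) : Q → Type _))
    (v : TangentBundle 𝓘(ℝ, E) Q) (u : TangentSpace 𝓘(ℝ, E) v.1) :
    tangentProj v (horizontalLift nabla v u) = u := by
  let s : Q → TangentBundle 𝓘(ℝ, E) Q := fun q ↦ ⟨q, FiberBundle.extend E v.2 q⟩
  have hv : s v.1 = v := by simp [s]
  have hs : MDifferentiableAt 𝓘(ℝ, E) 𝓘(ℝ, E).tangent s v.1 :=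
    FiberBundle.mdifferentiableAt_extend 𝓘(ℝ, E) E v.2
  have hp := (mdifferentiableAt_proj (TangentSpace 𝓘(ℝ, E)) (p := s v.1)
    (IB := 𝓘(ℝ, E))).hasMFDerivAt
  have h := (HasMFDerivAt.comp v.1 hp hs.hasMFDerivAt).mfderiv
  let P : TangentBundle 𝓘(ℝ, E) Q → (E × E →L[ℝ] E) := fun w ↦ tangentProj w
  have h0 : P (s v.1) = P v := congrArg P hv
  have h1 : P (s v.1) (mfderiv 𝓘(ℝ, E) 𝓘(ℝ, E).tangent s v.1 u) = u :=
    (congrArg (fun L : E →L[ℝ] E ↦ L u) h).symm.trans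
      (congrArg (fun L : E →L[ℝ] E ↦ L u) (mfderiv_id (I := 𝓘(ℝ, E)) (x := v.1)))
  rw [h0] at h1
  refine (map_sub (tangentProj v) (mfderiv 𝓘(ℝ, E) 𝓘(ℝ, E).tangent s v.1 u : E × E) _).trans ?_
  exact (congrArg₂ (fun a b : E ↦ a - b) h1 (tangentProj_verticalLift v _)).trans
    (sub_zero (u : E))

/-- `T_v TQ = H_v(TQ) ⊕ V_v(TQ)`. -/
theorem isCompl_horizontalSpace_verticalSpace
    (nabla : CovariantDerivative 𝓘(ℝ, E) E (TangentSpace 𝓘(ℝ, E) : Q → Type _))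
    (v : TangentBundle 𝓘(ℝ, E) Q) : IsCompl (horizontalSpace nabla v) (verticalSpace v) := by
  rw [isCompl_iff, Submodule.disjoint_def, Submodule.codisjoint_iff_exists_add_eq]
  constructor
  · rintro _ ⟨u, rfl⟩ h
    have := (tangentProj_horizontalLift nabla v u).symm.trans h
    rw [this]; exact map_zero (horizontalLift nabla v)
  · intro z
    refine ⟨horizontalLift nabla v (tangentProj v z),
      z - horizontalLift nabla v (tangentProj v z), ⟨_, rfl⟩, ?_, by abel⟩
    exact (map_sub (tangentProj v) z _).trans (by rw [tangentProj_horizontalLift, sub_self])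

end AffineControl

end

/-!
Let `Γ = Sym^(∞)(𝒴)`, a real vector space of analytic vector fields on `Q`, possibly of infinite
dimension. The proof uses the evaluation map `Φ : Q × Γ → TQ`, `Φ(q, ξ) = ξ(q)`. Its image is the
distribution `q ↦ Γ_q`, and its derivative at `(q, ξ)` sends `(a, η)` to `Tξ(a) + vlft(η(q))`. Call
a vector field `W` on `TQ` a lift of `(A, B)` if it is `Φ`-related to the vector field on `Q × Γ`
whose value at `(q, ξ)` is `((A ξ)(q), B ξ)`, where `A ξ` is an analytic vector field on `Q` and
`B ξ` is in `Γ`, both depending smoothly on `ξ`; this is `IsLift`.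

* The spray `Z` lifts `(ξ, -∇_ξ ξ)`, and `∇_ξ ξ = ½ ⟨ξ : ξ⟩` is in `Γ` although `∇_ξ η` need not be.
  The vertical lift `X^V` with `X ∈ Γ` lifts `(0, X)`.
* Related vector fields have related brackets (`mlieBracket_liftAlong`, `IsLift.mlieBracket`):
  `[W₁, W₂]` lifts `([A₁, A₂] + DA₂(B₁) - DA₁(B₂), DB₂(B₁) - DB₁(B₂))`, with derivatives in `ξ`.

Hence every member of `Lie^(∞)(Z, 𝒴^V)` is a lift (`exists_isLift_of_mem_accessibilityAlgebra`).
Conversely, `[Z, X^V]` lifts `(-X, ⟨ξ : X⟩)`, so that `[X₁^V, [Z, X₂^V]]` lifts `(0, ⟨X₁ : X₂⟩)`,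
and therefore every `(0, X)` with `X ∈ Γ` has a lift in `Lie^(∞)(Z, 𝒴^V)`
(`exists_isLift_zero_of_mem_symClosure`). Brackets of the fields `-[Z, X^V]` give lifts of some
`(X, B)` for every `X ∈ Lie^(∞)(Γ)` (`exists_isLift_of_mem_lieClosure_symClosure`).

Now let `v = ξ(q)` with `ξ ∈ Γ`. The value at `v` of a lift of `(A, B)` is
`hlft_v((A ξ)(q)) + vlft_v((∇_{A ξ} ξ + B ξ)(q))`. If it is vertical, then `(A ξ)(q) = 0`, and it is
`vlft_v` of a vector in `Γ_q`; together with the lifts of `(0, X)` this gives the isomorphism with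
the vertical part. For the horizontal part, take a lift of `(X, B)` with `X ∈ Lie^(∞)(Γ)`: as `∇`
restricts to `Γ`, the vertical part of its value is `vlft_v` of a vector in `Γ_q` and can be
subtracted.

The space `Γ` is given no topology. Smooth dependence on `ξ ∈ Γ` means that over any
finite-dimensional linear family in `Γ` the values are finite sums `∑ fᵢ(p) xᵢ` with smooth
functions `fᵢ` (`IsSmoothMap`); this notion is stable under the derivatives in the bracket formula.
The bracket formula is proved by differentiating the components of the fields in a chart of `TQ`
along sections `ξ` and along fibres.
-/

noncomputable section

namespace AffineControl

/-! ### Derivatives along vector fields and Lie brackets -/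

section Calculus

variable {E : Type*} [NormedAddCommGroup E] [NormedSpace ℝ E]
  {H : Type*} [TopologicalSpace H] {I : ModelWithCorners ℝ E H}
  {M : Type*} [TopologicalSpace M] [ChartedSpace H M]
  {F : Type*} [NormedAddCommGroup F] [NormedSpace ℝ F]

theorem _root_.Filter.EventuallyEq.mvfderiv_eq {f g : M → F} {x : M} (h : f =ᶠ[𝓝 x] g) :
    mvfderiv I f x = mvfderiv I g x :=
  ContinuousLinearMap.ext fun v ↦
    congrArg (fun L : E →L[ℝ] F ↦ L v) (h.mfderiv_eq (I := I) (I' := 𝓘(ℝ, F)))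

variable [IsManifold I ω M]

/-- The derivative of an analytic function along an analytic vector field is analytic. -/
theorem contMDiffAt_mvfderiv_apply [I.Boundaryless] {f : M → F} {x₀ : M}
    (hf : ContMDiffAt I 𝓘(ℝ, F) ω f x₀)
    {X : Π x : M, TangentSpace I x}
    (hX : ContMDiffAt I I.tangent ω (fun x ↦ (⟨x, X x⟩ : TangentBundle I M)) x₀) :
    ContMDiffAt I 𝓘(ℝ, F) ω (fun x ↦ mvfderiv I f x (X x)) x₀ := by
  have h1 : IsManifold I 1 M := inferInstance
  have hn : ∀ᶠ x in 𝓝 x₀, ContMDiffAt I 𝓘(ℝ, F) ω f x :=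
    (contMDiffAt_iff_contMDiffAt_nhds (by simp)).1 hf
  obtain ⟨u, hu, huo, hxu⟩ := eventually_nhds_iff.1 hn
  have hfu : ContMDiffOn I 𝓘(ℝ, F) ω f u := fun x hx ↦ (hu x hx).contMDiffWithinAt
  have ht := hfu.contMDiffOn_tangentMapWithin (m := ω) (by simp) huo.uniqueMDiffOn
  have ho : IsOpen (π E (TangentSpace I : M → Type _) ⁻¹' u) :=
    huo.preimage (FiberBundle.continuous_proj E _)
  have h2 : ContMDiffAt I.tangent 𝓘(ℝ, F).tangent ω (tangentMapWithin I 𝓘(ℝ, F) f u)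
      (⟨x₀, X x₀⟩ : TangentBundle I M) :=
    ht.contMDiffAt (ho.mem_nhds hxu)
  have h3 := (contMDiff_snd_tangentBundle_modelSpace (n := ω) F 𝓘(ℝ, F)).contMDiffAt.comp x₀
    (h2.comp x₀ hX)
  refine h3.congr_of_eventuallyEq ?_
  filter_upwards [huo.mem_nhds hxu] with x hx
  change _ = (mfderivWithin I 𝓘(ℝ, F) f u x) (X x)
  rw [mfderivWithin_of_isOpen huo hx]
  rfl

/-- In the chart at `x₀`, the derivative of a function along a vector field is the derivative of
its coordinate expression along the coordinate expression of the field. -/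
theorem mvfderiv_comp_extChartAt_apply {g : E → F} {x₀ x : M}
    (hx : x ∈ (extChartAt I x₀).source) (hg : DifferentiableAt ℝ g (extChartAt I x₀ x))
    (W : Π x : M, TangentSpace I x) :
    mvfderiv I (g ∘ extChartAt I x₀) x (W x) =
      fderiv ℝ g (extChartAt I x₀ x) (VectorField.mpullbackWithin 𝓘(ℝ, E) I (extChartAt I x₀).symm W
        (Set.range I) (extChartAt I x₀ x) : E) := by
  have hφ : MDifferentiableAt I 𝓘(ℝ, E) (extChartAt I x₀) x :=
    mdifferentiableAt_extChartAt (by simpa using hx)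
  have h1 := mfderiv_comp_apply x hg.mdifferentiableAt hφ (W x)
  have hinv : (extChartAt I x₀).symm (extChartAt I x₀ x) = x := (extChartAt I x₀).left_inv hx
  have h2 : VectorField.mpullbackWithin 𝓘(ℝ, E) I (extChartAt I x₀).symm W
        (Set.range I) (extChartAt I x₀ x) = mfderiv I 𝓘(ℝ, E) (extChartAt I x₀) x (W x) := by
    have hi := isInvertible_mfderivWithin_extChartAt_symm (I := I) (x := x₀)
      ((extChartAt I x₀).map_source hx)
    have hc := mfderivWithin_extChartAt_symm_comp_mfderiv_extChartAt' (I := I) hx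
    have hW : W ((extChartAt I x₀).symm (extChartAt I x₀ x)) =
        mfderivWithin 𝓘(ℝ, E) I (extChartAt I x₀).symm (Set.range I) (extChartAt I x₀ x)
          (mfderiv I 𝓘(ℝ, E) (extChartAt I x₀) x (W x)) := by
      have := congrArg (fun L : E →L[ℝ] E ↦ L (W x)) hc
      refine Eq.trans ?_ this.symm
      exact congrArg (fun y ↦ (W y : E)) hinv
    rw [VectorField.mpullbackWithin_apply, hW, hi.inverse_apply_eq]
  rw [h2]
  refine h1.trans ?_
  rw [mfderiv_eq_fderiv]
  rfl

/-- The derivative of a vector-valued function along a Lie bracket is the commutator of the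
derivatives along the two fields. -/
theorem mvfderiv_apply_mlieBracket [I.Boundaryless] [CompleteSpace E] {f : M → F} {x₀ : M}
    (hf : ContMDiffAt I 𝓘(ℝ, F) ω f x₀) {V W : Π x : M, TangentSpace I x}
    (hV : MDifferentiableAt I I.tangent (fun x ↦ (⟨x, V x⟩ : TangentBundle I M)) x₀)
    (hW : MDifferentiableAt I I.tangent (fun x ↦ (⟨x, W x⟩ : TangentBundle I M)) x₀) :
    mvfderiv I f x₀ (VectorField.mlieBracket I V W x₀) =
      mvfderiv I (fun x ↦ mvfderiv I f x (W x)) x₀ (V x₀) -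
        mvfderiv I (fun x ↦ mvfderiv I f x (V x)) x₀ (W x₀) := by
  have h2M : IsManifold I 2 M := inferInstance
  let φ := extChartAt I x₀
  -- `g` and `P W` are the coordinate expressions of `f` and of a vector field `W`
  let g : E → F := f ∘ φ.symm
  let P : (Π x : M, TangentSpace I x) → E → E := fun W ↦
    VectorField.mpullbackWithin 𝓘(ℝ, E) I φ.symm W (Set.range I)
  have hg : ContDiffAt ℝ ω g (φ x₀) := by
    have := (contMDiffAt_iff.1 hf).2
    rw [I.range_eq_univ, contDiffWithinAt_univ] at this
    exact this
  have hgn : ∀ᶠ x in 𝓝 x₀, x ∈ φ.source ∧ DifferentiableAt ℝ g (φ x) :=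
    Filter.Eventually.and (extChartAt_source_mem_nhds (I := I) x₀) <|
      (continuousAt_extChartAt (I := I) x₀).eventually <|
        (hg.eventually (by simp)).mono fun y hy ↦ hy.differentiableAt (by simp)
  have hfg : f =ᶠ[𝓝 x₀] g ∘ φ := by
    filter_upwards [extChartAt_source_mem_nhds (I := I) x₀] with x hx
    exact congrArg f ((extChartAt I x₀).left_inv hx).symm
  have hP {W : Π x : M, TangentSpace I x}
      (hW : MDifferentiableAt I I.tangent (fun x ↦ (⟨x, W x⟩ : TangentBundle I M)) x₀) :
      DifferentiableAt ℝ (P W) (φ x₀) := by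
    have h : DifferentiableWithinAt ℝ (P W) (φ.symm ⁻¹' Set.univ ∩ Set.range I) (φ x₀) :=
      (mdifferentiableWithinAt_univ.2 hW).differentiableWithinAt_mpullbackWithin_vectorField
    rwa [Set.preimage_univ, Set.univ_inter, I.range_eq_univ, differentiableWithinAt_univ] at h
  have hD (W : Π x : M, TangentSpace I x) : (fun x ↦ mvfderiv I f x (W x)) =ᶠ[𝓝 x₀]
      (fun y ↦ fderiv ℝ g y (P W y)) ∘ φ := by
    filter_upwards [hfg.eventuallyEq_nhds, hgn] with x h1 h2
    rw [h1.mvfderiv_eq]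
    exact mvfderiv_comp_extChartAt_apply h2.1 h2.2 W
  have hDD {V W : Π x : M, TangentSpace I x}
      (hW : MDifferentiableAt I I.tangent (fun x ↦ (⟨x, W x⟩ : TangentBundle I M)) x₀) :
      mvfderiv I (fun x ↦ mvfderiv I f x (W x)) x₀ (V x₀) =
        fderiv ℝ (fun y ↦ fderiv ℝ g y (P W y)) (φ x₀) (P V (φ x₀)) := by
    rw [(hD W).mvfderiv_eq]
    refine mvfderiv_comp_extChartAt_apply (mem_extChartAt_source x₀) ?_ V
    exact ((hg.fderiv_right (m := 1) (by simp)).differentiableAt (by simp)).clm_apply (hP hW)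
  rw [hDD hW, hDD hV, ← VectorField.fderiv_apply_lieBracket hg (by simp) (hP hW) (hP hV),
    hfg.mvfderiv_eq]
  have hφ : MDifferentiableAt I 𝓘(ℝ, E) φ x₀ :=
    mdifferentiableAt_extChartAt (mem_chart_source H x₀)
  have hc := mfderiv_comp_apply x₀ (hg.differentiableAt (by simp)).mdifferentiableAt hφ
    (VectorField.mlieBracket I V W x₀)
  refine hc.trans ?_
  rw [mfderiv_eq_fderiv]
  refine congrArg (fderiv ℝ g (φ x₀)) ?_
  let b : E :=
    VectorField.lieBracketWithin ℝ (P V) (P W) (φ.symm ⁻¹' Set.univ ∩ Set.range I) (φ x₀)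
  -- by definition, the bracket on `M` is the pullback of the bracket in the chart
  have hb : VectorField.mlieBracket I V W x₀ = (mfderiv I 𝓘(ℝ, E) φ x₀).inverse b := rfl
  have hb' : b = VectorField.lieBracket ℝ (P V) (P W) (φ x₀) := by
    simp only [b, Set.preimage_univ, Set.univ_inter, I.range_eq_univ,
      VectorField.lieBracketWithin_univ]
  rw [hb, ← hb']
  exact (isInvertible_mfderiv_extChartAt (mem_extChartAt_source x₀)).self_apply_inverse b

variable (I M) in
/-- The real vector space of analytic vector fields. -/
def analyticFields : Submodule ℝ (Π x : M, TangentSpace I x) where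
  carrier := {X | IsAnalyticField I X}
  add_mem' hX hY := ContMDiff.add_section hX hY
  zero_mem' := contMDiff_zeroSection ℝ (TangentSpace I : M → Type _)
  smul_mem' _ _ hX := ContMDiff.const_smul_section hX

theorem IsAnalyticField.mdifferentiableAt {X : Π x : M, TangentSpace I x}
    (hX : IsAnalyticField I X) (x : M) :
    MDifferentiableAt I I.tangent (fun x ↦ (⟨x, X x⟩ : TangentBundle I M)) x :=
  (hX x).mdifferentiableAt (by simp)

theorem IsAnalyticField.mlieBracket [CompleteSpace E] {X Y : Π x : M, TangentSpace I x}
    (hX : IsAnalyticField I X) (hY : IsAnalyticField I Y) :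
    IsAnalyticField I (VectorField.mlieBracket I X Y) := by
  have : IsManifold I (ω + 1) M := by simpa using ‹IsManifold I ω M›
  intro x
  have h := ContMDiffWithinAt.mlieBracketWithin_vectorField (m := ω) (n := ω)
    (contMDiffWithinAt_univ.2 (hX x)) (contMDiffWithinAt_univ.2 (hY x)) uniqueMDiffOn_univ
    (Set.mem_univ x) (by simp)
  rwa [VectorField.mlieBracketWithin_univ, contMDiffWithinAt_univ] at h

end Calculus

/-! ### Lifts along a section in a chart of the tangent bundle -/

section LiftAlong

variable {E : Type*} [NormedAddCommGroup E] [NormedSpace ℝ E]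
  {Q : Type*} [TopologicalSpace Q] [ChartedSpace E Q] [IsManifold 𝓘(ℝ, E) ω Q]

/-- The components, in the trivialization of the tangent bundle at `q₀`, of a vector field (zero
outside the domain of the chart at `q₀`). -/
def components (q₀ : Q) (X : Π q : Q, TangentSpace 𝓘(ℝ, E) q) : Q → E :=
  fun q ↦ (trivializationAt E (TangentSpace 𝓘(ℝ, E)) q₀).continuousLinearMapAt ℝ q (X q)

/-- The vector field `Tξ ∘ A + vlft ∘ B` along the section `ξ` of the tangent bundle: the velocity
of `ξ(q)` when `q` moves with velocity `A` and `ξ` itself moves with velocity `B`. Any derivative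
of `ξ(q)` as a function of both arguments has this form. -/
def liftAlong (ξ A B : Π q : Q, TangentSpace 𝓘(ℝ, E) q) (q : Q) :
    TangentSpace 𝓘(ℝ, E).tangent (⟨q, ξ q⟩ : TangentBundle 𝓘(ℝ, E) Q) :=
  (mfderiv 𝓘(ℝ, E) 𝓘(ℝ, E).tangent (fun q ↦ (⟨q, ξ q⟩ : TangentBundle 𝓘(ℝ, E) Q)) q (A q) :
    TangentSpace 𝓘(ℝ, E).tangent (⟨q, ξ q⟩ : TangentBundle 𝓘(ℝ, E) Q)) +
    verticalLift ⟨q, ξ q⟩ (B q)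

theorem components_self (q : Q) (X : Π q : Q, TangentSpace 𝓘(ℝ, E) q) :
    components q X q = X q :=
  ((trivializationAt E (TangentSpace 𝓘(ℝ, E)) q).continuousLinearMapAt_apply_of_mem ℝ
    (FiberBundle.mem_baseSet_trivializationAt' q) (X q)).trans
    (trivializationAt_self (E := E) q (X q))

theorem components_eq {q₀ q : Q} (hq : q ∈ (chartAt E q₀).source)
    (X : Π q : Q, TangentSpace 𝓘(ℝ, E) q) :
    components q₀ X q = (trivializationAt E (TangentSpace 𝓘(ℝ, E)) q₀ ⟨q, X q⟩).2 :=
  (trivializationAt E (TangentSpace 𝓘(ℝ, E)) q₀).continuousLinearMapAt_apply_of_mem ℝ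
    hq (X q)

theorem components_add_smul (q₀ : Q) (X Y : Π q : Q, TangentSpace 𝓘(ℝ, E) q) (t : ℝ) :
    components q₀ (X + t • Y) = components q₀ X + t • components q₀ Y := by
  funext q
  exact (map_add _ (X q) (t • Y q)).trans (congrArg _ (map_smul _ t (Y q)))

theorem IsAnalyticField.contMDiffAt_components {X : Π q : Q, TangentSpace 𝓘(ℝ, E) q}
    (hX : IsAnalyticField 𝓘(ℝ, E) X) (q₀ : Q) :
    ContMDiffAt 𝓘(ℝ, E) 𝓘(ℝ, E) ω (components q₀ X) q₀ := by
  refine ((contMDiffAt_section q₀).1 (hX q₀)).congr_of_eventuallyEq ?_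
  filter_upwards [(chartAt E q₀).open_source.mem_nhds (mem_chart_source E q₀)] with q hq
  exact components_eq hq X

theorem extChartAt_tangentBundle_apply (v₀ : TangentBundle 𝓘(ℝ, E) Q)
    (X : Π q : Q, TangentSpace 𝓘(ℝ, E) q) {q : Q}
    (hq : q ∈ (chartAt E v₀.1).source) :
    extChartAt 𝓘(ℝ, E).tangent v₀ (⟨q, X q⟩ : TangentBundle 𝓘(ℝ, E) Q) =
      (extChartAt 𝓘(ℝ, E) v₀.1 q, components v₀.1 X q) := by
  rw [components_eq hq, FiberBundle.extChartAt]
  rfl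

theorem mdifferentiableAt_extChartAt_tangentBundle (v₀ v : TangentBundle 𝓘(ℝ, E) Q)
    (hv : v.1 ∈ (chartAt E v₀.1).source) :
    MDifferentiableAt 𝓘(ℝ, E).tangent 𝓘(ℝ, E × E) (extChartAt 𝓘(ℝ, E).tangent v₀) v :=
  mdifferentiableAt_extChartAt ((TangentBundle.mem_chart_source_iff v v₀).2 hv)

theorem mvfderiv_extChartAt_verticalLift (v₀ v : TangentBundle 𝓘(ℝ, E) Q)
    (hv : v.1 ∈ (chartAt E v₀.1).source) (u : TangentSpace 𝓘(ℝ, E) v.1) :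
    mvfderiv 𝓘(ℝ, E).tangent (extChartAt 𝓘(ℝ, E).tangent v₀) v (verticalLift v u) =
      ((0, (trivializationAt E (TangentSpace 𝓘(ℝ, E)) v₀.1).continuousLinearMapAt ℝ v.1 u) :
        E × E) := by
  obtain ⟨q, w⟩ := v
  let L : E →L[ℝ] E := (trivializationAt E (TangentSpace 𝓘(ℝ, E)) v₀.1).continuousLinearMapAt ℝ q
  have h := mfderiv_comp_apply (I := 𝓘(ℝ, E)) (M := E) w
    (mdifferentiableAt_extChartAt_tangentBundle v₀ ⟨q, w⟩ hv)
    (mdifferentiableAt_fibreInclusion (E := E) q w) u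
  have he : (extChartAt 𝓘(ℝ, E).tangent v₀ ∘ fun w : E ↦ (⟨q, w⟩ : TangentBundle 𝓘(ℝ, E) Q)) =
      fun w : E ↦ (extChartAt 𝓘(ℝ, E) v₀.1 q, L w) := by
    funext w
    refine (extChartAt_tangentBundle_apply v₀ (fun _ ↦ w) hv).trans rfl
  have hd : HasFDerivAt (fun w : E ↦ (extChartAt 𝓘(ℝ, E) v₀.1 q, L w))
      ((0 : E →L[ℝ] E).prod L) w := (hasFDerivAt_const _ _).prodMk L.hasFDerivAt
  rw [he] at h
  refine h.symm.trans ?_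
  exact congrArg (fun T : E →L[ℝ] E × E ↦ T u) hd.hasMFDerivAt.mfderiv

theorem mvfderiv_extChartAt_liftAlong (v₀ : TangentBundle 𝓘(ℝ, E) Q)
    {ξ : Π q : Q, TangentSpace 𝓘(ℝ, E) q} {q : Q} (hq : q ∈ (chartAt E v₀.1).source)
    (hξ : MDifferentiableAt 𝓘(ℝ, E) 𝓘(ℝ, E).tangent
      (fun q ↦ (⟨q, ξ q⟩ : TangentBundle 𝓘(ℝ, E) Q)) q)
    (A B : Π q : Q, TangentSpace 𝓘(ℝ, E) q) :
    mvfderiv 𝓘(ℝ, E).tangent (extChartAt 𝓘(ℝ, E).tangent v₀) ⟨q, ξ q⟩ (liftAlong ξ A B q) =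
      mvfderiv 𝓘(ℝ, E) (fun q ↦ extChartAt 𝓘(ℝ, E).tangent v₀
        (⟨q, ξ q⟩ : TangentBundle 𝓘(ℝ, E) Q)) q (A q) + ((0, components v₀.1 B q) : E × E) := by
  have h := mfderiv_comp_apply q (mdifferentiableAt_extChartAt_tangentBundle v₀ ⟨q, ξ q⟩ hq)
    hξ (A q)
  refine (map_add (mvfderiv 𝓘(ℝ, E).tangent (extChartAt 𝓘(ℝ, E).tangent v₀) ⟨q, ξ q⟩)
    _ _).trans ?_
  exact congrArg₂ (fun a b : E × E ↦ a + b) h.symm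
    (mvfderiv_extChartAt_verticalLift v₀ ⟨q, ξ q⟩ hq (B q))

/-- In the chart at `v₀`, the section `ξ + t η` is `ξ` translated by `t` times the components
of `η`; this is the corresponding statement for the derivatives. -/
theorem mvfderiv_extChartAt_add_smul (v₀ : TangentBundle 𝓘(ℝ, E) Q)
    {ξ η : Π q : Q, TangentSpace 𝓘(ℝ, E) q} (hξ : IsAnalyticField 𝓘(ℝ, E) ξ)
    (hη : IsAnalyticField 𝓘(ℝ, E) η) (t : ℝ) (u : TangentSpace 𝓘(ℝ, E) v₀.1) :
    mvfderiv 𝓘(ℝ, E) (fun q ↦ extChartAt 𝓘(ℝ, E).tangent v₀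
        (⟨q, (ξ + t • η) q⟩ : TangentBundle 𝓘(ℝ, E) Q)) v₀.1 u =
      mvfderiv 𝓘(ℝ, E) (fun q ↦ extChartAt 𝓘(ℝ, E).tangent v₀
        (⟨q, ξ q⟩ : TangentBundle 𝓘(ℝ, E) Q)) v₀.1 u +
        t • ((0, mvfderiv 𝓘(ℝ, E) (components v₀.1 η) v₀.1 u) : E × E) := by
  let f : Q → E × E := fun q ↦ extChartAt 𝓘(ℝ, E).tangent v₀
        (⟨q, ξ q⟩ : TangentBundle 𝓘(ℝ, E) Q)
  have hf : MDifferentiableAt 𝓘(ℝ, E) 𝓘(ℝ, E × E) f v₀.1 :=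
    (mdifferentiableAt_extChartAt_tangentBundle v₀ ⟨v₀.1, ξ v₀.1⟩ (mem_chart_source E v₀.1)).comp
      v₀.1 (hξ.mdifferentiableAt v₀.1)
  let L : E →L[ℝ] E × E := t • ContinuousLinearMap.inr ℝ E E
  have hc : MDifferentiableAt 𝓘(ℝ, E) 𝓘(ℝ, E) (components v₀.1 η) v₀.1 :=
    (hη.contMDiffAt_components v₀.1).mdifferentiableAt (by simp)
  have hL : MDifferentiableAt 𝓘(ℝ, E) 𝓘(ℝ, E × E) (L ∘ components v₀.1 η) v₀.1 :=
    L.mdifferentiableAt.comp v₀.1 hc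
  have he : (fun q ↦ extChartAt 𝓘(ℝ, E).tangent v₀
        (⟨q, (ξ + t • η) q⟩ : TangentBundle 𝓘(ℝ, E) Q)) =ᶠ[𝓝 v₀.1] f + L ∘ components v₀.1 η := by
    filter_upwards [(chartAt E v₀.1).open_source.mem_nhds (mem_chart_source E v₀.1)] with q hq
    rw [extChartAt_tangentBundle_apply v₀ (ξ + t • η) hq, components_add_smul]
    change _ = f q + _
    rw [show f q = _ from extChartAt_tangentBundle_apply v₀ ξ hq]
    simp [L]
  rw [he.mvfderiv_eq, mvfderiv_add hf hL]
  refine congrArg (fun x ↦ mvfderiv 𝓘(ℝ, E) f v₀.1 u + x) ?_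
  refine (mfderiv_comp_apply v₀.1 L.mdifferentiableAt hc u).trans ?_
  rw [mfderiv_eq_fderiv, L.fderiv]
  rfl

end LiftAlong

/-! ### The bracket of two lifts along a section -/

section Bracket

variable {E : Type*} [NormedAddCommGroup E] [NormedSpace ℝ E]
  {Q : Type*} [TopologicalSpace Q] [ChartedSpace E Q] [IsManifold 𝓘(ℝ, E) ω Q]

theorem mvfderiv_verticalLift_eq_deriv {F : Type*} [NormedAddCommGroup F] [NormedSpace ℝ F]
    {g : TangentBundle 𝓘(ℝ, E) Q → F} {v : TangentBundle 𝓘(ℝ, E) Q}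
    (hg : MDifferentiableAt 𝓘(ℝ, E).tangent 𝓘(ℝ, F) g v) (u : TangentSpace 𝓘(ℝ, E) v.1) :
    mvfderiv 𝓘(ℝ, E).tangent g v (verticalLift v u) =
      deriv (fun t : ℝ ↦ g (⟨v.1, v.2 + t • u⟩ : TangentBundle 𝓘(ℝ, E) Q)) 0 := by
  obtain ⟨q, w⟩ := v
  change E at w u
  let c : ℝ → E := fun t ↦ w + t • u
  have hc : HasFDerivAt c ((ContinuousLinearMap.id ℝ ℝ).smulRight u) 0 :=
    ((ContinuousLinearMap.id ℝ ℝ).smulRight u).hasFDerivAt.const_add w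
  have h0 : c 0 = w := by simp [c]
  let γ : ℝ → TangentBundle 𝓘(ℝ, E) Q := fun t ↦ ⟨q, w + t • u⟩
  have hγ : MDifferentiableAt 𝓘(ℝ, ℝ) 𝓘(ℝ, E).tangent γ 0 :=
    (mdifferentiableAt_fibreInclusion (E := E) q (c 0)).comp (0 : ℝ)
      hc.differentiableAt.mdifferentiableAt
  have hγ0 : γ 0 = ⟨q, w⟩ := congrArg (fun w : E ↦ (⟨q, w⟩ : TangentBundle 𝓘(ℝ, E) Q)) h0
  have h := mfderiv_comp_apply_of_eq (0 : ℝ) hg hγ hγ0 (1 : ℝ)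
  rw [mfderiv_eq_fderiv] at h
  refine (Eq.trans ?_ h.symm)
  exact congrArg (fun x : E × E ↦ mvfderiv 𝓘(ℝ, E).tangent g ⟨q, w⟩ x)
    (verticalLift_eq_velocity (⟨q, w⟩ : TangentBundle 𝓘(ℝ, E) Q) u)

/-- Let `f` be the section `ξ` read in the chart `ψ` of `TQ` at `ξ(q₀)`, and let `W` be a vector
field on `TQ` with `W(ξ(q)) = Tξ(X') + vlft(Y')` for all `q`, and with
`W = T(ξ + tη)(α t) + vlft(β t)` at `(ξ + tη)(q₀)` for all `t`. The components of `W` are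
differentiated at `ξ(q₀)` in the direction `Tξ(X) + vlft(η)`: the first summand is a derivative
along the section `ξ`, the second one a derivative along the fibre, where the point
`ξ(q₀) + tη(q₀)` is reached by the section `ξ + tη`. -/
theorem mvfderiv_mvfderiv_extChartAt_liftAlong {ξ X η X' Y' : Π q : Q, TangentSpace 𝓘(ℝ, E) q}
    {W : Π v : TangentBundle 𝓘(ℝ, E) Q, TangentSpace 𝓘(ℝ, E).tangent v} {q₀ : Q}
    (hW : IsAnalyticField 𝓘(ℝ, E).tangent W) (hξ : IsAnalyticField 𝓘(ℝ, E) ξ)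
    (hη : IsAnalyticField 𝓘(ℝ, E) η) (hX' : IsAnalyticField 𝓘(ℝ, E) X')
    (hY' : IsAnalyticField 𝓘(ℝ, E) Y')
    (h0 : ∀ q, W ⟨q, ξ q⟩ = liftAlong ξ X' Y' q)
    {α β : ℝ → Π q : Q, TangentSpace 𝓘(ℝ, E) q}
    (ht : ∀ t : ℝ, W ⟨q₀, (ξ + t • η) q₀⟩ = liftAlong (ξ + t • η) (α t) (β t) q₀)
    {a : TangentSpace 𝓘(ℝ, E) q₀} {b : E} (hα : HasDerivAt (F := E) (fun t ↦ α t q₀) a 0)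
    (hβ : HasDerivAt (F := E) (fun t ↦ β t q₀) b 0) (hα0 : α 0 = X') :
    letI ψ : TangentBundle 𝓘(ℝ, E) Q → E × E :=
      extChartAt 𝓘(ℝ, E).tangent (⟨q₀, ξ q₀⟩ : TangentBundle 𝓘(ℝ, E) Q)
    letI f : Q → E × E := fun q ↦ ψ ⟨q, ξ q⟩
    mvfderiv 𝓘(ℝ, E).tangent (fun v ↦ mvfderiv 𝓘(ℝ, E).tangent ψ v (W v)) ⟨q₀, ξ q₀⟩
      (liftAlong ξ X η q₀) =
      mvfderiv 𝓘(ℝ, E) (fun q ↦ mvfderiv 𝓘(ℝ, E) f q (X' q)) q₀ (X q₀) +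
        mvfderiv 𝓘(ℝ, E) f q₀ a +
        ((0, mvfderiv 𝓘(ℝ, E) (components q₀ Y') q₀ (X q₀) +
          mvfderiv 𝓘(ℝ, E) (components q₀ η) q₀ (X' q₀) + b) : E × E) := by
  let ψ : TangentBundle 𝓘(ℝ, E) Q → E × E :=
    extChartAt 𝓘(ℝ, E).tangent (⟨q₀, ξ q₀⟩ : TangentBundle 𝓘(ℝ, E) Q)
  let f : Q → E × E := fun q ↦ ψ ⟨q, ξ q⟩
  let v₀ : TangentBundle 𝓘(ℝ, E) Q := ⟨q₀, ξ q₀⟩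
  let g : TangentBundle 𝓘(ℝ, E) Q → E × E := fun v ↦ mvfderiv 𝓘(ℝ, E).tangent ψ v (W v)
  have hψ : ContMDiffAt 𝓘(ℝ, E).tangent 𝓘(ℝ, E × E) ω ψ v₀ := contMDiffAt_extChartAt
  have hf : ContMDiffAt 𝓘(ℝ, E) 𝓘(ℝ, E × E) ω f q₀ := ContMDiffAt.comp q₀ hψ (hξ q₀)
  have hg : MDifferentiableAt 𝓘(ℝ, E).tangent 𝓘(ℝ, E × E) g v₀ :=
    (contMDiffAt_mvfderiv_apply hψ (hW v₀)).mdifferentiableAt (by simp)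
  have hfX : MDifferentiableAt 𝓘(ℝ, E) 𝓘(ℝ, E × E) (fun q ↦ mvfderiv 𝓘(ℝ, E) f q (X' q)) q₀ :=
    (contMDiffAt_mvfderiv_apply hf (hX' q₀)).mdifferentiableAt (by simp)
  have hc : MDifferentiableAt 𝓘(ℝ, E) 𝓘(ℝ, E) (components q₀ Y') q₀ :=
    (hY'.contMDiffAt_components q₀).mdifferentiableAt (by simp)
  let L : E →L[ℝ] E × E := ContinuousLinearMap.inr ℝ E E
  have hL : MDifferentiableAt 𝓘(ℝ, E) 𝓘(ℝ, E × E) (L ∘ components q₀ Y') q₀ :=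
    L.mdifferentiableAt.comp q₀ hc
  -- the derivative along the section `ξ`
  have e1 : mvfderiv 𝓘(ℝ, E).tangent g v₀ (mfderiv 𝓘(ℝ, E) 𝓘(ℝ, E).tangent
      (fun q ↦ (⟨q, ξ q⟩ : TangentBundle 𝓘(ℝ, E) Q)) q₀ (X q₀)) =
      mvfderiv 𝓘(ℝ, E) (fun q ↦ mvfderiv 𝓘(ℝ, E) f q (X' q)) q₀ (X q₀) +
        ((0, mvfderiv 𝓘(ℝ, E) (components q₀ Y') q₀ (X q₀)) : E × E) := by
    have h1 := mfderiv_comp_apply q₀ hg (hξ.mdifferentiableAt q₀) (X q₀)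
    have h2 : (g ∘ fun q ↦ (⟨q, ξ q⟩ : TangentBundle 𝓘(ℝ, E) Q)) =ᶠ[𝓝 q₀]
        (fun q ↦ mvfderiv 𝓘(ℝ, E) f q (X' q)) + L ∘ components q₀ Y' := by
      filter_upwards [(chartAt E q₀).open_source.mem_nhds (mem_chart_source E q₀)] with q hq
      change mvfderiv 𝓘(ℝ, E).tangent ψ ⟨q, ξ q⟩ (W ⟨q, ξ q⟩) = _
      rw [h0]
      exact mvfderiv_extChartAt_liftAlong v₀ hq (hξ.mdifferentiableAt q) X' Y'
    refine h1.symm.trans ?_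
    change mvfderiv 𝓘(ℝ, E) (g ∘ fun q ↦ (⟨q, ξ q⟩ : TangentBundle 𝓘(ℝ, E) Q)) q₀ (X q₀) = _
    rw [h2.mvfderiv_eq, mvfderiv_add hfX hL]
    refine congrArg (fun x : E × E ↦
      mvfderiv 𝓘(ℝ, E) (fun q ↦ mvfderiv 𝓘(ℝ, E) f q (X' q)) q₀ (X q₀) + x) ?_
    refine (mfderiv_comp_apply q₀ L.mdifferentiableAt hc (X q₀)).trans ?_
    rw [mfderiv_eq_fderiv, L.fderiv]
    rfl
  -- the derivative along the fibre
  have e2 : mvfderiv 𝓘(ℝ, E).tangent g v₀ (verticalLift v₀ (η q₀)) =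
      mvfderiv 𝓘(ℝ, E) f q₀ a +
        ((0, mvfderiv 𝓘(ℝ, E) (components q₀ η) q₀ (X' q₀) + b) : E × E) := by
    rw [mvfderiv_verticalLift_eq_deriv hg]
    let D : E →L[ℝ] E × E := mvfderiv 𝓘(ℝ, E) f q₀
    let K : E →L[ℝ] E := mvfderiv 𝓘(ℝ, E) (components q₀ η) q₀
    let a' : ℝ → E := fun t ↦ α t q₀
    let b' : ℝ → E := fun t ↦ β t q₀
    have h2 : (fun t : ℝ ↦ g (⟨v₀.1, v₀.2 + t • η q₀⟩ : TangentBundle 𝓘(ℝ, E) Q)) =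
        fun t ↦ D (a' t) + t • L (K (a' t)) + L (b' t) := by
      funext t
      change mvfderiv 𝓘(ℝ, E).tangent ψ ⟨q₀, (ξ + t • η) q₀⟩ (W ⟨q₀, (ξ + t • η) q₀⟩) = _
      have hξt : IsAnalyticField 𝓘(ℝ, E) (ξ + t • η) :=
        (analyticFields 𝓘(ℝ, E) Q).add_mem hξ ((analyticFields 𝓘(ℝ, E) Q).smul_mem t hη)
      rw [ht]
      refine (mvfderiv_extChartAt_liftAlong v₀ (mem_chart_source E q₀)
        (hξt.mdifferentiableAt q₀) (α t) (β t)).trans ?_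
      refine congrArg₂ (fun x y : E × E ↦ x + y) ?_ ?_
      · exact mvfderiv_extChartAt_add_smul v₀ hξ hη t (α t q₀)
      · exact congrArg L (components_self q₀ (β t))
    have hd1 : HasDerivAt (fun t ↦ D (a' t)) (D a) 0 := D.hasFDerivAt.comp_hasDerivAt 0 hα
    have hd2 : HasDerivAt (fun t ↦ t • L (K (a' t))) (L (K (a' 0))) 0 := by
      have := (hasDerivAt_id (0 : ℝ)).smul ((L.comp K).hasFDerivAt.comp_hasDerivAt 0 hα)
      simpa using! this
    have hd3 : HasDerivAt (fun t ↦ L (b' t)) (L b) 0 := L.hasFDerivAt.comp_hasDerivAt 0 hβ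
    have ha0 : a' 0 = X' q₀ := congrFun hα0 q₀
    rw [ha0] at hd2
    refine (congrArg (fun c : ℝ → E × E ↦ deriv c 0) h2).trans ?_
    refine ((hd1.add hd2).add hd3).deriv.trans ?_
    have key (p : E × E) (x y : E) : p + L x + L y = p + (0, x + y) := by
      ext <;> simp [L, add_assoc]
    exact key _ _ _
  refine (map_add (mvfderiv 𝓘(ℝ, E).tangent g v₀) _ _).trans ?_
  refine (congrArg₂ (fun x y : E × E ↦ x + y) e1 e2).trans ?_
  have key (p d : E × E) (x y z : E) :
      (p + (0, x)) + (d + (0, y + z)) = p + d + (0, x + y + z) := by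
    ext <;> (simp; try abel)
  exact key _ _ _ _ _

/-- **Bracket formula.** Suppose that `W₁` and `W₂` are the lifts of `(X₁, Y₁)` and `(X₂, Y₂)`
along `ξ`, and that along the nearby sections `ξ + t Y₂` and `ξ + t Y₁` they are lifts of pairs
whose derivatives at `t = 0` are `(a₁, b₁)` and `(a₂, b₂)`. Then `[W₁, W₂]` is along `ξ` the lift of
`([X₁, X₂] + a₂ - a₁, b₂ - b₁)`: this is the bracket of vector fields on the product of `Q` with a
space of sections. Both sides are compared in the chart at `ξ(q₀)`, where the terms that are not
in the formula are symmetric in the two fields and cancel. -/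
theorem mlieBracket_liftAlong [CompleteSpace E]
    {ξ X₁ Y₁ X₂ Y₂ A B : Π q : Q, TangentSpace 𝓘(ℝ, E) q}
    {W₁ W₂ : Π v : TangentBundle 𝓘(ℝ, E) Q, TangentSpace 𝓘(ℝ, E).tangent v} {q₀ : Q}
    (hW₁ : IsAnalyticField 𝓘(ℝ, E).tangent W₁) (hW₂ : IsAnalyticField 𝓘(ℝ, E).tangent W₂)
    (hξ : IsAnalyticField 𝓘(ℝ, E) ξ)
    (hX₁ : IsAnalyticField 𝓘(ℝ, E) X₁) (hY₁ : IsAnalyticField 𝓘(ℝ, E) Y₁)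
    (hX₂ : IsAnalyticField 𝓘(ℝ, E) X₂) (hY₂ : IsAnalyticField 𝓘(ℝ, E) Y₂)
    (h₁ : ∀ q, W₁ ⟨q, ξ q⟩ = liftAlong ξ X₁ Y₁ q) (h₂ : ∀ q, W₂ ⟨q, ξ q⟩ = liftAlong ξ X₂ Y₂ q)
    {α₁ β₁ α₂ β₂ : ℝ → Π q : Q, TangentSpace 𝓘(ℝ, E) q}
    (ht₁ : ∀ t : ℝ, W₁ ⟨q₀, (ξ + t • Y₂) q₀⟩ = liftAlong (ξ + t • Y₂) (α₁ t) (β₁ t) q₀)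
    (ht₂ : ∀ t : ℝ, W₂ ⟨q₀, (ξ + t • Y₁) q₀⟩ = liftAlong (ξ + t • Y₁) (α₂ t) (β₂ t) q₀)
    {a₁ a₂ b₁ b₂ : TangentSpace 𝓘(ℝ, E) q₀}
    (hα₁ : HasDerivAt (F := E) (fun t ↦ α₁ t q₀) a₁ 0)
    (hβ₁ : HasDerivAt (F := E) (fun t ↦ β₁ t q₀) b₁ 0)
    (hα₂ : HasDerivAt (F := E) (fun t ↦ α₂ t q₀) a₂ 0)
    (hβ₂ : HasDerivAt (F := E) (fun t ↦ β₂ t q₀) b₂ 0)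
    (h₁0 : α₁ 0 = X₁) (h₂0 : α₂ 0 = X₂)
    (hA : A q₀ = VectorField.mlieBracket 𝓘(ℝ, E) X₁ X₂ q₀ + a₂ - a₁) (hB : B q₀ = b₂ - b₁) :
    VectorField.mlieBracket 𝓘(ℝ, E).tangent W₁ W₂ ⟨q₀, ξ q₀⟩ = liftAlong ξ A B q₀ := by
  let v₀ : TangentBundle 𝓘(ℝ, E) Q := ⟨q₀, ξ q₀⟩
  let ψ : TangentBundle 𝓘(ℝ, E) Q → E × E := extChartAt 𝓘(ℝ, E).tangent v₀
  let f : Q → E × E := fun q ↦ ψ ⟨q, ξ q⟩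
  have hψ : ContMDiffAt 𝓘(ℝ, E).tangent 𝓘(ℝ, E × E) ω ψ v₀ := contMDiffAt_extChartAt
  have hf : ContMDiffAt 𝓘(ℝ, E) 𝓘(ℝ, E × E) ω f q₀ := ContMDiffAt.comp q₀ hψ (hξ q₀)
  have hinj : Function.Injective (mvfderiv 𝓘(ℝ, E).tangent ψ v₀) := by
    intro x y hxy
    have h := mfderiv_extChartAt_self (I := 𝓘(ℝ, E).tangent) (x := v₀)
    have hx := congrArg (fun T : E × E →L[ℝ] E × E ↦ T x) h
    have hy := congrArg (fun T : E × E →L[ℝ] E × E ↦ T y) h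
    exact hx.symm.trans (Eq.trans hxy hy)
  apply hinj
  refine (mvfderiv_apply_mlieBracket hψ (hW₁.mdifferentiableAt v₀)
    (hW₂.mdifferentiableAt v₀)).trans ?_
  have e₁ : W₁ v₀ = liftAlong ξ X₁ Y₁ q₀ := h₁ q₀
  have e₂ : W₂ v₀ = liftAlong ξ X₂ Y₂ q₀ := h₂ q₀
  rw [e₁, e₂]
  have k₂ := mvfderiv_mvfderiv_extChartAt_liftAlong (X := X₁) hW₂ hξ hY₁ hX₂ hY₂ h₂ ht₂ hα₂ hβ₂ h₂0
  have k₁ := mvfderiv_mvfderiv_extChartAt_liftAlong (X := X₂) hW₁ hξ hY₂ hX₁ hY₁ h₁ ht₁ hα₁ hβ₁ h₁0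
  refine (congrArg₂ (fun x y : E × E ↦ x - y) k₂ k₁).trans ?_
  refine Eq.trans ?_ (mvfderiv_extChartAt_liftAlong v₀ (mem_chart_source E q₀)
    (hξ.mdifferentiableAt q₀) A B).symm
  have hb := mvfderiv_apply_mlieBracket hf (hX₁.mdifferentiableAt q₀) (hX₂.mdifferentiableAt q₀)
  have hA' : mvfderiv 𝓘(ℝ, E) f q₀ (A q₀) =
      mvfderiv 𝓘(ℝ, E) (fun q ↦ mvfderiv 𝓘(ℝ, E) f q (X₂ q)) q₀ (X₁ q₀) -
        mvfderiv 𝓘(ℝ, E) (fun q ↦ mvfderiv 𝓘(ℝ, E) f q (X₁ q)) q₀ (X₂ q₀) +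
        mvfderiv 𝓘(ℝ, E) f q₀ a₂ - mvfderiv 𝓘(ℝ, E) f q₀ a₁ := by
    rw [hA, map_sub, map_add, hb]
  have hB' : ((0, components q₀ B q₀) : E × E) = (0, b₂) - (0, b₁) := by
    rw [components_self, hB]
    exact Prod.ext (sub_zero (0 : E)).symm rfl
  refine Eq.trans ?_ (congrArg₂ (fun x y : E × E ↦ x + y) hA' hB').symm
  have key (p p' d d' : E × E) (x y b b' : E) :
      p + d + (0, x + y + b) - (p' + d' + (0, y + x + b')) =
        p - p' + d - d' + ((0, b) - (0, b')) := by
    ext <;> (simp; try abel)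
  exact key _ _ _ _ _ _ _ _

end Bracket

/-! ### Analyticity of the vertical lifts and of the geodesic spray -/

section Criterion

variable {E : Type*} [NormedAddCommGroup E] [NormedSpace ℝ E]
  {H : Type*} [TopologicalSpace H] {I : ModelWithCorners ℝ E H}
  {M : Type*} [TopologicalSpace M] [ChartedSpace H M] [IsManifold I ω M]

/-- A vector field is analytic if its components in the charts are. -/
theorem isAnalyticField_of_mvfderiv_extChartAt {W : Π x : M, TangentSpace I x}
    (h : ∀ x₀, ContMDiffAt I 𝓘(ℝ, E) ω (fun x ↦ mvfderiv I (extChartAt I x₀) x (W x)) x₀) :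
    IsAnalyticField I W := by
  intro x₀
  refine (contMDiffAt_section x₀).2 ((h x₀).congr_of_eventuallyEq ?_)
  filter_upwards [(chartAt H x₀).open_source.mem_nhds (mem_chart_source H x₀)] with x hx
  have h1 :=
    (trivializationAt E (TangentSpace I : M → Type _) x₀).continuousLinearMapAt_apply_of_mem ℝ
      (b := x) hx (W x)
  have h2 := TangentBundle.continuousLinearMapAt_trivializationAt (I := I) hx
  exact h1.symm.trans (congrArg (fun L : E →L[ℝ] E ↦ L (W x)) h2)

end Criterion

section Spray

variable {E : Type*} [NormedAddCommGroup E] [NormedSpace ℝ E]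
  {Q : Type*} [TopologicalSpace Q] [ChartedSpace E Q] [IsManifold 𝓘(ℝ, E) ω Q]

theorem IsAnalyticField.verticalLiftField {X : Π q : Q, TangentSpace 𝓘(ℝ, E) q}
    (hX : IsAnalyticField 𝓘(ℝ, E) X) :
    IsAnalyticField 𝓘(ℝ, E).tangent (verticalLiftField X) := by
  refine isAnalyticField_of_mvfderiv_extChartAt fun v₀ ↦ ?_
  have h : ContMDiffAt 𝓘(ℝ, E).tangent 𝓘(ℝ, E × E) ω
      (fun v : TangentBundle 𝓘(ℝ, E) Q ↦ ((0, components v₀.1 X v.1) : E × E)) v₀ :=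
    contMDiffAt_const.prodMk_space
      (ContMDiffAt.comp v₀ (hX.contMDiffAt_components v₀.1) (contMDiffAt_proj _))
  refine h.congr_of_eventuallyEq ?_
  filter_upwards [((chartAt E v₀.1).open_source.preimage
    (FiberBundle.continuous_proj E (TangentSpace 𝓘(ℝ, E) : Q → Type _))).mem_nhds
      (mem_chart_source E v₀.1)] with v hv
  exact mvfderiv_extChartAt_verticalLift v₀ v hv (X v.1)

theorem IsAnalyticConnection.contMDiffOn
    {nabla : CovariantDerivative 𝓘(ℝ, E) E (TangentSpace 𝓘(ℝ, E) : Q → Type _)}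
    (hnabla : IsAnalyticConnection nabla) {u : Set Q} (hu : IsOpen u)
    {X Y : Π q : Q, TangentSpace 𝓘(ℝ, E) q}
    (hX : ContMDiffOn 𝓘(ℝ, E) 𝓘(ℝ, E).tangent ω
      (fun q ↦ (⟨q, X q⟩ : TangentBundle 𝓘(ℝ, E) Q)) u)
    (hY : ContMDiffOn 𝓘(ℝ, E) 𝓘(ℝ, E).tangent ω
      (fun q ↦ (⟨q, Y q⟩ : TangentBundle 𝓘(ℝ, E) Q)) u) :
    ContMDiffOn 𝓘(ℝ, E) 𝓘(ℝ, E).tangent ω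
      (fun q ↦ (⟨q, nabla Y q (X q)⟩ : TangentBundle 𝓘(ℝ, E) Q)) u :=
  ContMDiffOn.clm_bundle_apply ((hnabla u hu).contMDiff (by simpa using hY)) hX

theorem IsAnalyticConnection.isAnalyticField
    {nabla : CovariantDerivative 𝓘(ℝ, E) E (TangentSpace 𝓘(ℝ, E) : Q → Type _)}
    (hnabla : IsAnalyticConnection nabla) {X Y : Π q : Q, TangentSpace 𝓘(ℝ, E) q}
    (hX : IsAnalyticField 𝓘(ℝ, E) X) (hY : IsAnalyticField 𝓘(ℝ, E) Y) :
    IsAnalyticField 𝓘(ℝ, E) (fun q ↦ nabla Y q (X q)) :=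
  contMDiffOn_univ.1 <| hnabla.contMDiffOn isOpen_univ (contMDiffOn_univ.2 hX)
    (contMDiffOn_univ.2 hY)

/-- The field with constant components `y` in the trivialization at `q₀`
(extended by zero outside the domain of the trivialization). -/
def constantField (q₀ : Q) (y : E) : Π q : Q, TangentSpace 𝓘(ℝ, E) q :=
  fun q ↦ (trivializationAt E (TangentSpace 𝓘(ℝ, E)) q₀).symmL ℝ q y

theorem components_constantField {q₀ q : Q} (hq : q ∈ (chartAt E q₀).source) (y : E) :
    components q₀ (constantField q₀ y) q = y :=
  (trivializationAt E (TangentSpace 𝓘(ℝ, E)) q₀).continuousLinearMapAt_symmL (R := ℝ) hq y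

theorem constantField_apply {q₀ q : Q} (hq : q ∈ (chartAt E q₀).source)
    (w : TangentSpace 𝓘(ℝ, E) q) :
    constantField q₀
      ((trivializationAt E (TangentSpace 𝓘(ℝ, E)) q₀).continuousLinearMapAt ℝ q w) q = w :=
  (trivializationAt E (TangentSpace 𝓘(ℝ, E)) q₀).symmL_continuousLinearMapAt (R := ℝ) hq w

theorem contMDiffOn_constantField (q₀ : Q) (y : E) :
    ContMDiffOn 𝓘(ℝ, E) 𝓘(ℝ, E).tangent ω
      (fun q ↦ (⟨q, constantField q₀ y q⟩ : TangentBundle 𝓘(ℝ, E) Q)) (chartAt E q₀).source := by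
  refine ((trivializationAt E (TangentSpace 𝓘(ℝ, E)) q₀).contMDiffOn_section_baseSet_iff).2 ?_
  refine (contMDiffOn_const (c := y)).congr fun q hq ↦ ?_
  exact (components_eq hq _).symm.trans (components_constantField hq y)

theorem mdifferentiableAt_constantField {q₀ q : Q} (hq : q ∈ (chartAt E q₀).source) (y : E) :
    MDifferentiableAt 𝓘(ℝ, E) 𝓘(ℝ, E).tangent
      (fun q ↦ (⟨q, constantField q₀ y q⟩ : TangentBundle 𝓘(ℝ, E) Q)) q :=
  ((contMDiffOn_constantField q₀ y).contMDiffAt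
    ((chartAt E q₀).open_source.mem_nhds hq)).mdifferentiableAt (by simp)

/-- Along a section `ξ`, the geodesic spray is `Tξ(ξ) - vlft(∇_ξ ξ)`. -/
theorem geodesicSpray_section [FiniteDimensional ℝ E]
    (nabla : CovariantDerivative 𝓘(ℝ, E) E (TangentSpace 𝓘(ℝ, E) : Q → Type _))
    {ξ : Π q : Q, TangentSpace 𝓘(ℝ, E) q} {q : Q}
    (hξ : MDifferentiableAt 𝓘(ℝ, E) 𝓘(ℝ, E).tangent
      (fun q ↦ (⟨q, ξ q⟩ : TangentBundle 𝓘(ℝ, E) Q)) q) :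
    geodesicSpray nabla ⟨q, ξ q⟩ = liftAlong ξ ξ (fun q ↦ -nabla ξ q (ξ q)) q := by
  refine (horizontalLift_eq nabla q ξ hξ (ξ q)).trans ?_
  rw [sub_eq_add_neg, ← map_neg]
  rfl

/-- The coordinate expression of the geodesic spray. The constant field through `v` is used as the
section, so that the second component is minus the Christoffel term `∇_y y`. -/
theorem mvfderiv_extChartAt_geodesicSpray [FiniteDimensional ℝ E]
    (nabla : CovariantDerivative 𝓘(ℝ, E) E (TangentSpace 𝓘(ℝ, E) : Q → Type _))
    (v₀ v : TangentBundle 𝓘(ℝ, E) Q) (hv : v.1 ∈ (chartAt E v₀.1).source)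
    {y : E} (hy : (trivializationAt E (TangentSpace 𝓘(ℝ, E)) v₀.1 v).2 = y) :
    mvfderiv 𝓘(ℝ, E).tangent (extChartAt 𝓘(ℝ, E).tangent v₀) v (geodesicSpray nabla v) =
      ((y, -components v₀.1 (fun q ↦ nabla (constantField v₀.1 y) q (constantField v₀.1 y q)) v.1) :
        E × E) := by
  obtain ⟨q, w⟩ := v
  have hy' : (trivializationAt E (TangentSpace 𝓘(ℝ, E)) v₀.1).continuousLinearMapAt ℝ q w = y :=
    (components_eq hv (fun _ ↦ w)).trans hy
  have hw : constantField v₀.1 y q = w := by rw [← hy']; exact constantField_apply hv w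
  subst hw
  rw [geodesicSpray_section nabla (mdifferentiableAt_constantField hv y)]
  refine (mvfderiv_extChartAt_liftAlong v₀ hv (mdifferentiableAt_constantField hv y) _ _).trans ?_
  have he : (fun q ↦ extChartAt 𝓘(ℝ, E).tangent v₀
      (⟨q, constantField v₀.1 y q⟩ : TangentBundle 𝓘(ℝ, E) Q)) =ᶠ[𝓝 q]
      fun q ↦ (extChartAt 𝓘(ℝ, E) v₀.1 q, y) := by
    filter_upwards [(chartAt E v₀.1).open_source.mem_nhds hv] with q hq
    rw [extChartAt_tangentBundle_apply v₀ _ hq, components_constantField hq]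
  have hg : HasFDerivAt (fun e : E ↦ (e, y)) (ContinuousLinearMap.inl ℝ E E)
      (extChartAt 𝓘(ℝ, E) v₀.1 q) := (hasFDerivAt_id _).prodMk (hasFDerivAt_const y _)
  have hφy : mfderiv 𝓘(ℝ, E) 𝓘(ℝ, E) (extChartAt 𝓘(ℝ, E) v₀.1) q (constantField v₀.1 y q) = y := by
    rw [← TangentBundle.continuousLinearMapAt_trivializationAt hv]
    exact components_constantField hv y
  have h1 : mvfderiv 𝓘(ℝ, E) (fun q ↦ extChartAt 𝓘(ℝ, E).tangent v₀
      (⟨q, constantField v₀.1 y q⟩ : TangentBundle 𝓘(ℝ, E) Q)) q (constantField v₀.1 y q) =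
      ((y, 0) : E × E) := by
    rw [he.mvfderiv_eq]
    refine (mfderiv_comp_apply q hg.differentiableAt.mdifferentiableAt
      (mdifferentiableAt_extChartAt hv) (constantField v₀.1 y q)).trans ?_
    rw [hφy, mfderiv_eq_fderiv, hg.fderiv]
    rfl
  have h2 : components v₀.1
      (fun q ↦ -nabla (constantField v₀.1 y) q (constantField v₀.1 y q)) q =
      -components v₀.1 (fun q ↦ nabla (constantField v₀.1 y) q (constantField v₀.1 y q)) q :=
    map_neg _ _
  rw [h1, h2]
  exact Prod.ext (add_zero y) (zero_add (-_ : E))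

/-- The Christoffel term is a quadratic form in `y`, whose coefficients are the Christoffel symbols
of the basis `b`. -/
theorem nabla_constantField_eq_sum [FiniteDimensional ℝ E]
    (nabla : CovariantDerivative 𝓘(ℝ, E) E (TangentSpace 𝓘(ℝ, E) : Q → Type _))
    {ι : Type*} [Fintype ι] (b : Module.Basis ι ℝ E)
    {q₀ q : Q} (hq : q ∈ (chartAt E q₀).source) (y : E) :
    components q₀ (fun q ↦ nabla (constantField q₀ y) q (constantField q₀ y q)) q =
      ∑ i, ∑ j, (b.repr y i * b.repr y j) •
        components q₀ (fun q ↦ nabla (constantField q₀ (b i)) q (constantField q₀ (b j) q)) q := by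
  let c : E →ₗ[ℝ] TangentSpace 𝓘(ℝ, E) q :=
    ((trivializationAt E (TangentSpace 𝓘(ℝ, E)) q₀).symmL ℝ q).toLinearMap
  let l : TangentSpace 𝓘(ℝ, E) q →ₗ[ℝ] E :=
    ((trivializationAt E (TangentSpace 𝓘(ℝ, E)) q₀).continuousLinearMapAt ℝ q).toLinearMap
  let T : E →ₗ[ℝ] TangentSpace 𝓘(ℝ, E) q →L[ℝ] TangentSpace 𝓘(ℝ, E) q :=
    { toFun y := nabla (constantField q₀ y) q
      map_add' y z := by
        have h : constantField q₀ (y + z) = constantField q₀ y + constantField q₀ z :=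
          funext fun q ↦ map_add _ y z
        rw [h]
        exact nabla.isCovariantDerivativeOnUniv.add (mdifferentiableAt_constantField hq y)
          (mdifferentiableAt_constantField hq z)
      map_smul' t y := by
        have h : constantField q₀ (t • y) = t • constantField q₀ y :=
          funext fun q ↦ map_smul _ t y
        rw [h]
        exact nabla.isCovariantDerivativeOnUniv.smul_const t
          (mdifferentiableAt_constantField hq y) }
  change l (T y (c y)) = ∑ i, ∑ j, (b.repr y i * b.repr y j) • l (T (b i) (c (b j)))
  have h1 : T y = ∑ i, b.repr y i • T (b i) := by
    conv_lhs => rw [← b.sum_repr y]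
    simp only [map_sum, map_smul]
  have h2 : c y = ∑ j, b.repr y j • c (b j) := by
    conv_lhs => rw [← b.sum_repr y]
    simp only [map_sum, map_smul]
  rw [h1, h2]
  simp only [map_sum, map_smul, sum_apply, smul_apply,
    Finset.smul_sum, smul_smul]
  rw [Finset.sum_comm]
  simp only [mul_comm]

theorem IsAnalyticConnection.isAnalyticField_geodesicSpray [FiniteDimensional ℝ E]
    {nabla : CovariantDerivative 𝓘(ℝ, E) E (TangentSpace 𝓘(ℝ, E) : Q → Type _)}
    (hnabla : IsAnalyticConnection nabla) :
    IsAnalyticField 𝓘(ℝ, E).tangent (geodesicSpray nabla) := by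
  refine isAnalyticField_of_mvfderiv_extChartAt fun v₀ ↦ ?_
  let b := Module.finBasis ℝ E
  let y : TangentBundle 𝓘(ℝ, E) Q → E := fun v ↦
    (trivializationAt E (TangentSpace 𝓘(ℝ, E)) v₀.1 v).2
  have hy : ContMDiffAt 𝓘(ℝ, E).tangent 𝓘(ℝ, E) ω y v₀ :=
    (contMDiffAt_totalSpace.1 (contMDiffAt_id (x := v₀))).2
  have hyi (i) : ContMDiffAt 𝓘(ℝ, E).tangent 𝓘(ℝ, ℝ) ω (fun v ↦ b.repr (y v) i) v₀ :=
    (LinearMap.toContinuousLinearMap (b.coord i)).contMDiff.contMDiffAt.comp v₀ hy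
  -- the Christoffel symbols
  let G : Fin _ → Fin _ → Q → E := fun i j ↦ components v₀.1
    (fun q ↦ nabla (constantField v₀.1 (b i)) q (constantField v₀.1 (b j) q))
  have hG (i j) : ContMDiffAt 𝓘(ℝ, E) 𝓘(ℝ, E) ω (G i j) v₀.1 := by
    have h := (hnabla.contMDiffOn (chartAt E v₀.1).open_source
      (contMDiffOn_constantField v₀.1 (b j))
      (contMDiffOn_constantField v₀.1 (b i))).contMDiffAt
        ((chartAt E v₀.1).open_source.mem_nhds (mem_chart_source E v₀.1))
    refine ((contMDiffAt_section v₀.1).1 h).congr_of_eventuallyEq ?_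
    filter_upwards [(chartAt E v₀.1).open_source.mem_nhds (mem_chart_source E v₀.1)] with q hq
    exact components_eq hq _
  have h : ContMDiffAt 𝓘(ℝ, E).tangent 𝓘(ℝ, E × E) ω (fun v ↦ ((y v,
      -∑ i, ∑ j, (b.repr (y v) i * b.repr (y v) j) • G i j v.1) : E × E)) v₀ := by
    refine hy.prodMk_space (ContMDiffAt.neg ?_)
    refine ContMDiffAt.sum fun i _ ↦ ContMDiffAt.sum fun j _ ↦ ?_
    exact ((hyi i).mul (hyi j)).smul (ContMDiffAt.comp v₀ (hG i j) (contMDiffAt_proj _))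
  refine h.congr_of_eventuallyEq ?_
  filter_upwards [((chartAt E v₀.1).open_source.preimage
    (FiberBundle.continuous_proj E (TangentSpace 𝓘(ℝ, E) : Q → Type _))).mem_nhds
      (mem_chart_source E v₀.1)] with v hv
  rw [mvfderiv_extChartAt_geodesicSpray nabla v₀ v hv rfl, nabla_constantField_eq_sum nabla b hv]

end Spray

/-! ### Smooth maps between spaces of vector fields -/

section SmoothFamilies

variable {V : Type*} [AddCommGroup V] [Module ℝ V]
  {P : Type} [NormedAddCommGroup P] [NormedSpace ℝ P]
  {P' : Type} [NormedAddCommGroup P'] [NormedSpace ℝ P']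

/-- The families `P → V` of the form `p ↦ ∑ fᵢ(p) xᵢ`, a finite sum with smooth real functions
`fᵢ` and vectors `xᵢ ∈ L`. -/
def smoothFamilies (P : Type) [NormedAddCommGroup P] [NormedSpace ℝ P] (L : Submodule ℝ V) :
    Submodule ℝ (P → V) :=
  Submodule.span ℝ {F | ∃ f : P → ℝ, ContDiff ℝ ∞ f ∧ ∃ x ∈ L, F = fun p ↦ f p • x}

variable {L L' L'' : Submodule ℝ V}

theorem smul_mem_smoothFamilies {f : P → ℝ} (hf : ContDiff ℝ ∞ f) {x : V} (hx : x ∈ L) :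
    (fun p ↦ f p • x) ∈ smoothFamilies P L :=
  Submodule.subset_span ⟨f, hf, x, hx, rfl⟩

theorem mem_of_mem_smoothFamilies {F : P → V} (hF : F ∈ smoothFamilies P L) (p : P) : F p ∈ L := by
  induction hF using Submodule.span_induction with
  | mem F h => obtain ⟨f, -, x, hx, rfl⟩ := h; exact L.smul_mem _ hx
  | zero => exact L.zero_mem
  | add F G _ _ hF hG => exact L.add_mem hF hG
  | smul c F _ hF => exact L.smul_mem c hF

theorem comp_mem_smoothFamilies {F : P → V} (hF : F ∈ smoothFamilies P L) {g : P' → P}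
    (hg : ContDiff ℝ ∞ g) : F ∘ g ∈ smoothFamilies P' L := by
  induction hF using Submodule.span_induction with
  | mem F h =>
    obtain ⟨f, hf, x, hx, rfl⟩ := h
    exact smul_mem_smoothFamilies (hf.comp hg) hx
  | zero => exact (smoothFamilies P' L).zero_mem
  | add F G _ _ hF hG => exact (smoothFamilies P' L).add_mem hF hG
  | smul c F _ hF => exact (smoothFamilies P' L).smul_mem c hF

/-- A smooth family is a smooth map into a finite-dimensional space followed by a linear map. -/
theorem exists_linearMap_of_mem_smoothFamilies {F : P → V} (hF : F ∈ smoothFamilies P L) :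
    ∃ (n : ℕ) (g : P → Fin n → ℝ) (κ : (Fin n → ℝ) →ₗ[ℝ] V),
      ContDiff ℝ ∞ g ∧ (∀ c, κ c ∈ L) ∧ ∀ p, F p = κ (g p) := by
  induction hF using Submodule.span_induction with
  | mem F h =>
    obtain ⟨f, hf, x, hx, rfl⟩ := h
    exact ⟨1, fun p _ ↦ f p, (LinearMap.proj 0).smulRight x, contDiff_pi.2 fun _ ↦ hf,
      fun c ↦ L.smul_mem _ hx, fun p ↦ rfl⟩
  | zero => exact ⟨0, fun _ ↦ 0, 0, contDiff_const, fun c ↦ L.zero_mem, fun p ↦ rfl⟩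
  | add F G _ _ hF hG =>
    obtain ⟨n, g, κ, hg, hκ, h⟩ := hF
    obtain ⟨n', g', κ', hg', hκ', h'⟩ := hG
    refine ⟨n + n', fun p ↦ Fin.append (g p) (g' p),
      κ ∘ₗ LinearMap.funLeft ℝ ℝ (Fin.castAdd n') + κ' ∘ₗ LinearMap.funLeft ℝ ℝ (Fin.natAdd n),
      contDiff_pi.2 fun i ↦ ?_, fun c ↦ L.add_mem (hκ _) (hκ' _), fun p ↦ ?_⟩
    · refine Fin.addCases (fun i ↦ ?_) (fun i ↦ ?_) i
      · simpa using contDiff_pi.1 hg i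
      · simpa using contDiff_pi.1 hg' i
    · have e : LinearMap.funLeft ℝ ℝ (Fin.castAdd n') (Fin.append (g p) (g' p)) = g p := by
        ext i; simp [LinearMap.funLeft_apply]
      have e' : LinearMap.funLeft ℝ ℝ (Fin.natAdd n) (Fin.append (g p) (g' p)) = g' p := by
        ext i; simp [LinearMap.funLeft_apply]
      simp [e, e', h, h']
  | smul c F _ hF =>
    obtain ⟨n, g, κ, hg, hκ, h⟩ := hF
    exact ⟨n, g, c • κ, hg, fun a ↦ L.smul_mem c (hκ a), fun p ↦ by simp [h]⟩

/-- The directional derivatives of a smooth family form a smooth family. -/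
theorem exists_deriv_of_mem_smoothFamilies {F : P → V} (hF : F ∈ smoothFamilies P L) :
    ∃ F' ∈ smoothFamilies (P × P) L, ∀ {E : Type*} [NormedAddCommGroup E] [NormedSpace ℝ E]
      (l : V →ₗ[ℝ] E) (p e : P), HasDerivAt (fun t : ℝ ↦ l (F (p + t • e))) (l (F' (p, e))) 0 := by
  induction hF using Submodule.span_induction with
  | mem F h =>
    obtain ⟨f, hf, x, hx, rfl⟩ := h
    refine ⟨fun p ↦ fderiv ℝ f p.1 p.2 • x, smul_mem_smoothFamilies ?_ hx, fun l p e ↦ ?_⟩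
    · exact ((hf.fderiv_right (m := ∞) (by simp)).comp contDiff_fst).clm_apply contDiff_snd
    · have h1 : HasDerivAt (fun t : ℝ ↦ p + t • e) e 0 := by
        simpa using! ((hasDerivAt_id (0 : ℝ)).smul_const e).const_add p
      have h2 : HasFDerivAt f (fderiv ℝ f p) (p + (0 : ℝ) • e) := by
        rw [zero_smul, add_zero]
        exact (hf.differentiable (by simp) p).hasFDerivAt
      simpa only [map_smul] using! (h2.comp_hasDerivAt 0 h1).smul_const (l x)
  | zero => exact ⟨0, Submodule.zero_mem _, fun l p e ↦ by simpa using! hasDerivAt_const 0 (0 : _)⟩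
  | add F G _ _ hF hG =>
    obtain ⟨F', hF', h⟩ := hF
    obtain ⟨G', hG', h'⟩ := hG
    refine ⟨F' + G', Submodule.add_mem _ hF' hG', fun l p e ↦ ?_⟩
    simpa only [Pi.add_apply, map_add] using! (h l p e).add (h' l p e)
  | smul c F _ hF =>
    obtain ⟨F', hF', h⟩ := hF
    refine ⟨c • F', Submodule.smul_mem _ c hF', fun l p e ↦ ?_⟩
    simpa only [Pi.smul_apply, map_smul] using! (h l p e).const_smul c

/-- An operation that is bilinear on vectors of `L` and `L'` preserves smooth families. -/
theorem bilinear_mem_smoothFamilies {m : V → V → V}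
    (hm : ∀ x ∈ L, ∀ y ∈ L', m x y ∈ L'')
    (hl : ∀ x ∈ L, ∀ x' ∈ L, ∀ y ∈ L', m (x + x') y = m x y + m x' y)
    (hr : ∀ x ∈ L, ∀ y ∈ L', ∀ y' ∈ L', m x (y + y') = m x y + m x y')
    (hls : ∀ c : ℝ, ∀ x ∈ L, ∀ y ∈ L', m (c • x) y = c • m x y)
    (hrs : ∀ c : ℝ, ∀ x ∈ L, ∀ y ∈ L', m x (c • y) = c • m x y)
    {F G : P → V} (hF : F ∈ smoothFamilies P L) (hG : G ∈ smoothFamilies P L') :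
    (fun p ↦ m (F p) (G p)) ∈ smoothFamilies P L'' := by
  induction hF using Submodule.span_induction with
  | mem F h =>
    obtain ⟨f, hf, x, hx, rfl⟩ := h
    have hfx (p : P) : f p • x ∈ L := L.smul_mem _ hx
    induction hG using Submodule.span_induction with
    | mem G h =>
      obtain ⟨g, hg, y, hy, rfl⟩ := h
      convert! smul_mem_smoothFamilies (hf.mul hg) (hm x hx y hy) using 1
      funext p
      rw [hls _ _ hx _ (L'.smul_mem _ hy), hrs _ _ hx _ hy, smul_smul]
    | zero =>
      convert! (smoothFamilies P L'').zero_mem using 1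
      funext p
      simpa using hrs 0 _ (hfx p) 0 L'.zero_mem
    | add G₁ G₂ h₁ h₂ hG₁ hG₂ =>
      convert! (smoothFamilies P L'').add_mem hG₁ hG₂ using 1
      funext p
      exact hr _ (hfx p) _ (mem_of_mem_smoothFamilies h₁ p) _ (mem_of_mem_smoothFamilies h₂ p)
    | smul c G h hG =>
      convert! (smoothFamilies P L'').smul_mem c hG using 1
      funext p
      exact hrs c _ (hfx p) _ (mem_of_mem_smoothFamilies h p)
  | zero =>
    convert! (smoothFamilies P L'').zero_mem using 1
    funext p
    simpa using hls 0 0 L.zero_mem _ (mem_of_mem_smoothFamilies hG p)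
  | add F₁ F₂ h₁ h₂ hF₁ hF₂ =>
    convert! (smoothFamilies P L'').add_mem hF₁ hF₂ using 1
    funext p
    exact hl _ (mem_of_mem_smoothFamilies h₁ p) _ (mem_of_mem_smoothFamilies h₂ p) _
      (mem_of_mem_smoothFamilies hG p)
  | smul c F h hF =>
    convert! (smoothFamilies P L'').smul_mem c hF using 1
    funext p
    exact hls c _ (mem_of_mem_smoothFamilies h p) _ (mem_of_mem_smoothFamilies hG p)

theorem linearMap_mem_smoothFamilies [FiniteDimensional ℝ P] {ι : P →ₗ[ℝ] V}
    (hι : ∀ p, ι p ∈ L) :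
    ⇑ι ∈ smoothFamilies P L := by
  let b := Module.finBasis ℝ P
  have h : ⇑ι = ∑ i, fun p ↦ b.coord i p • ι (b i) := by
    funext p
    conv_lhs => rw [← b.sum_repr p]
    simp only [map_sum, map_smul, Finset.sum_apply, Module.Basis.coord_apply]
  rw [h]
  exact Submodule.sum_mem _ fun i _ ↦
    smul_mem_smoothFamilies (LinearMap.toContinuousLinearMap (b.coord i)).contDiff (hι _)

end SmoothFamilies

section SmoothMaps

variable {V : Type*} [AddCommGroup V] [Module ℝ V] {Γ L L' L'' : Submodule ℝ V}

/-- `A` is smooth on `Γ`, with values in `L`: its composition with every linear map from some `ℝⁿ`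
into `Γ` is a smooth family in `L`. No topology on the spaces of vectors is involved. -/
def IsSmoothMap (Γ L : Submodule ℝ V) (A : V → V) : Prop :=
  ∀ (n : ℕ) (ι : (Fin n → ℝ) →ₗ[ℝ] V), (∀ p, ι p ∈ Γ) → A ∘ ι ∈ smoothFamilies (Fin n → ℝ) L

/-- Any finite-dimensional parameter space may be used in place of `ℝⁿ`. -/
theorem IsSmoothMap.comp_linearMap {A : V → V} (hA : IsSmoothMap Γ L A) {P : Type}
    [NormedAddCommGroup P] [NormedSpace ℝ P] [FiniteDimensional ℝ P] {ι : P →ₗ[ℝ] V}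
    (hι : ∀ p, ι p ∈ Γ) : A ∘ ι ∈ smoothFamilies P L := by
  let e := (Module.finBasis ℝ P).equivFun.toContinuousLinearEquiv
  have h := comp_mem_smoothFamilies
    (hA _ (ι ∘ₗ e.symm.toLinearEquiv.toLinearMap) fun p ↦ hι _) e.contDiff
  convert! h using 1
  funext p
  simp

theorem IsSmoothMap.mem {A : V → V} (hA : IsSmoothMap Γ L A) {ξ : V} (hξ : ξ ∈ Γ) : A ξ ∈ L := by
  have h := mem_of_mem_smoothFamilies (hA.comp_linearMap
    (ι := LinearMap.toSpanSingleton ℝ V ξ) fun p ↦ Γ.smul_mem p hξ) 1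
  simpa using h

theorem IsSmoothMap.congr {A B : V → V} (hA : IsSmoothMap Γ L A) (h : ∀ ξ ∈ Γ, A ξ = B ξ) :
    IsSmoothMap Γ L B := by
  intro n ι hι
  convert! hA n ι hι using 1
  exact funext fun p ↦ (h _ (hι p)).symm

theorem IsSmoothMap.const {x : V} (hx : x ∈ L) : IsSmoothMap Γ L fun _ ↦ x := by
  intro n ι _
  simpa using! smul_mem_smoothFamilies (P := Fin n → ℝ) (contDiff_const (c := (1 : ℝ))) hx

theorem IsSmoothMap.id (h : Γ ≤ L) : IsSmoothMap Γ L fun ξ ↦ ξ :=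
  fun _ _ hι ↦ linearMap_mem_smoothFamilies fun p ↦ h (hι p)

theorem IsSmoothMap.add {A B : V → V} (hA : IsSmoothMap Γ L A) (hB : IsSmoothMap Γ L B) :
    IsSmoothMap Γ L fun ξ ↦ A ξ + B ξ :=
  fun n ι hι ↦ Submodule.add_mem _ (hA n ι hι) (hB n ι hι)

theorem IsSmoothMap.sub {A B : V → V} (hA : IsSmoothMap Γ L A) (hB : IsSmoothMap Γ L B) :
    IsSmoothMap Γ L fun ξ ↦ A ξ - B ξ :=
  fun n ι hι ↦ Submodule.sub_mem _ (hA n ι hι) (hB n ι hι)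

theorem IsSmoothMap.const_smul {A : V → V} (c : ℝ) (hA : IsSmoothMap Γ L A) :
    IsSmoothMap Γ L fun ξ ↦ c • A ξ :=
  fun n ι hι ↦ Submodule.smul_mem _ c (hA n ι hι)

theorem IsSmoothMap.bilinear {m : V → V → V}
    (hm : ∀ x ∈ L, ∀ y ∈ L', m x y ∈ L'')
    (hl : ∀ x ∈ L, ∀ x' ∈ L, ∀ y ∈ L', m (x + x') y = m x y + m x' y)
    (hr : ∀ x ∈ L, ∀ y ∈ L', ∀ y' ∈ L', m x (y + y') = m x y + m x y')
    (hls : ∀ c : ℝ, ∀ x ∈ L, ∀ y ∈ L', m (c • x) y = c • m x y)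
    (hrs : ∀ c : ℝ, ∀ x ∈ L, ∀ y ∈ L', m x (c • y) = c • m x y)
    {A B : V → V} (hA : IsSmoothMap Γ L A) (hB : IsSmoothMap Γ L' B) :
    IsSmoothMap Γ L'' fun ξ ↦ m (A ξ) (B ξ) :=
  fun n ι hι ↦ bilinear_mem_smoothFamilies hm hl hr hls hrs (hA n ι hι) (hB n ι hι)

end SmoothMaps

section LineDerivative

variable {E : Type*} [NormedAddCommGroup E] [NormedSpace ℝ E]
  {Q : Type*} [TopologicalSpace Q] [ChartedSpace E Q]
  {Γ L : Submodule ℝ (Π q : Q, TangentSpace 𝓘(ℝ, E) q)}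
  {A B : (Π q : Q, TangentSpace 𝓘(ℝ, E) q) → Π q : Q, TangentSpace 𝓘(ℝ, E) q}

/-- The derivative at `ξ` in the direction `η` of a map `A` of vector fields to vector fields,
computed pointwise (with the junk value `0` at points where it does not exist). -/
def fieldDeriv (A : (Π q : Q, TangentSpace 𝓘(ℝ, E) q) → Π q : Q, TangentSpace 𝓘(ℝ, E) q)
    (ξ η : Π q : Q, TangentSpace 𝓘(ℝ, E) q) : Π q : Q, TangentSpace 𝓘(ℝ, E) q :=
  fun q ↦ deriv (F := E) (fun t : ℝ ↦ A (ξ + t • η) q) 0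

/-- Evaluation of vector fields at `q`, with values in the model space. -/
def evalAt (q : Q) : (Π q : Q, TangentSpace 𝓘(ℝ, E) q) →ₗ[ℝ] E :=
  LinearMap.proj (φ := fun q : Q ↦ TangentSpace 𝓘(ℝ, E) q) q

theorem IsSmoothMap.hasDerivAt_fieldDeriv (hA : IsSmoothMap Γ L A)
    {ξ η : Π q : Q, TangentSpace 𝓘(ℝ, E) q} (hξ : ξ ∈ Γ) (hη : η ∈ Γ) (q : Q) :
    HasDerivAt (F := E) (fun t : ℝ ↦ A (ξ + t • η) q) (fieldDeriv A ξ η q) 0 := by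
  let ι : ℝ × ℝ →ₗ[ℝ] Π q : Q, TangentSpace 𝓘(ℝ, E) q :=
    (LinearMap.toSpanSingleton ℝ _ ξ).coprod (LinearMap.toSpanSingleton ℝ _ η)
  obtain ⟨F', -, hF'⟩ := exists_deriv_of_mem_smoothFamilies (hA.comp_linearMap (ι := ι)
    fun p ↦ Γ.add_mem (Γ.smul_mem p.1 hξ) (Γ.smul_mem p.2 hη))
  have h := hF' (evalAt q) (1, 0) (0, 1)
  have he : (fun t : ℝ ↦ evalAt q ((A ∘ ι) ((1, 0) + t • (0, 1)))) =
      fun t : ℝ ↦ (A (ξ + t • η) q : E) := by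
    funext t
    have : ι ((1, 0) + t • (0, 1)) = ξ + t • η := by simp [ι]
    rw [Function.comp_apply, this]
    rfl
  rw [he] at h
  exact h.differentiableAt.hasDerivAt

/-- The derivative of a smooth map along a smooth field of directions is smooth: on a
finite-dimensional family `ι p`, the direction `B (ι p)` is `κ (g p)` with `κ` linear, so that only
the finite-dimensional family `ι p + κ c` matters. -/
theorem IsSmoothMap.fieldDeriv (hA : IsSmoothMap Γ L A) (hB : IsSmoothMap Γ Γ B) :
    IsSmoothMap Γ L fun ξ ↦ fieldDeriv A ξ (B ξ) := by
  intro n ι hι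
  obtain ⟨k, g, κ, hg, hκ, h⟩ := exists_linearMap_of_mem_smoothFamilies (hB n ι hι)
  obtain ⟨F', hF', hd⟩ := exists_deriv_of_mem_smoothFamilies (hA.comp_linearMap
    (ι := ι.coprod κ) fun p ↦ Γ.add_mem (hι p.1) (hκ p.2))
  convert! comp_mem_smoothFamilies hF' (g := fun p ↦ ((p, 0), (0, g p)))
    ((contDiff_id.prodMk contDiff_const).prodMk (contDiff_const.prodMk hg)) using 1
  funext p q
  refine Eq.trans ?_ (hd (evalAt q) (p, 0) (0, g p)).deriv
  change deriv (F := E) (fun t : ℝ ↦ A (ι p + t • B (ι p)) q) 0 = _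
  congr 1
  funext t
  have h1 : ι.coprod κ ((p, 0) + t • (0, g p)) = ι p + t • B (ι p) := by
    rw [show B (ι p) = κ (g p) from h p]
    simp
  rw [Function.comp_apply, h1]
  rfl

theorem fieldDeriv_const (X ξ η : Π q : Q, TangentSpace 𝓘(ℝ, E) q) :
    fieldDeriv (fun _ ↦ X) ξ η = 0 :=
  funext fun q ↦ deriv_const (F := E) (0 : ℝ) (X q)

/-- The derivative of a map that is quadratic along the line `ξ + t η`. -/
theorem fieldDeriv_eq_of_forall {ξ η : Π q : Q, TangentSpace 𝓘(ℝ, E) q}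
    {X Y Z : Π q : Q, TangentSpace 𝓘(ℝ, E) q}
    (h : ∀ t : ℝ, A (ξ + t • η) = X + t • Y + (t * t) • Z) : fieldDeriv A ξ η = Y := by
  funext q
  have h1 : (fun t : ℝ ↦ (A (ξ + t • η) q : E)) =
      fun t : ℝ ↦ evalAt q X + t • evalAt q Y + (t * t) • evalAt q Z := by
    funext t
    rw [h]
    rfl
  have h2 : HasDerivAt (fun t : ℝ ↦ evalAt q X + t • evalAt q Y + (t * t) • evalAt q Z)
      (evalAt q Y) 0 := by
    have a := (hasDerivAt_id (0 : ℝ)).smul_const (evalAt q Y)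
    have b := ((hasDerivAt_id (0 : ℝ)).mul (hasDerivAt_id (0 : ℝ))).smul_const (evalAt q Z)
    simpa using! (a.const_add (evalAt q X)).add b
  exact (congrArg (fun f : ℝ → E ↦ deriv f 0) h1).trans h2.deriv

theorem fieldDeriv_id (ξ η : Π q : Q, TangentSpace 𝓘(ℝ, E) q) :
    fieldDeriv (fun ξ ↦ ξ) ξ η = η :=
  fieldDeriv_eq_of_forall (X := ξ) (Z := 0) fun t ↦ by simp

end LineDerivative

section Lifts

variable {E : Type*} [NormedAddCommGroup E] [NormedSpace ℝ E]
  {Q : Type*} [TopologicalSpace Q] [ChartedSpace E Q] [IsManifold 𝓘(ℝ, E) ω Q]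
  {nabla : CovariantDerivative 𝓘(ℝ, E) E (TangentSpace 𝓘(ℝ, E) : Q → Type _)}
  {Γ : Submodule ℝ (Π q : Q, TangentSpace 𝓘(ℝ, E) q)}
  {S : Set (Π q : Q, TangentSpace 𝓘(ℝ, E) q)}

/-! ### Symmetric and involutive closures -/

theorem subset_symClosure : S ⊆ symClosure nabla S :=
  fun _ hX ↦ Submodule.mem_sInf.2 fun _ hL ↦ hL.1 hX

theorem symProduct_mem_symClosure {X Y : Π q : Q, TangentSpace 𝓘(ℝ, E) q}
    (hX : X ∈ symClosure nabla S) (hY : Y ∈ symClosure nabla S) :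
    symProduct nabla X Y ∈ symClosure nabla S :=
  Submodule.mem_sInf.2 fun L hL ↦ hL.2 X (Submodule.mem_sInf.1 hX L hL) Y
    (Submodule.mem_sInf.1 hY L hL)

theorem symClosure_le (hS : S ⊆ Γ)
    (h : ∀ X ∈ Γ, ∀ Y ∈ Γ, symProduct nabla X Y ∈ Γ) : symClosure nabla S ≤ Γ :=
  sInf_le ⟨hS, h⟩

theorem IsAnalyticConnection.symClosure_le_analyticFields (hnabla : IsAnalyticConnection nabla)
    (hS : S ⊆ analyticFields 𝓘(ℝ, E) Q) : symClosure nabla S ≤ analyticFields 𝓘(ℝ, E) Q :=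
  symClosure_le hS fun _ hX _ hY ↦ (analyticFields 𝓘(ℝ, E) Q).add_mem
    (hnabla.isAnalyticField hX hY) (hnabla.isAnalyticField hY hX)

section LieClosure

variable {H : Type*} [TopologicalSpace H] {I : ModelWithCorners ℝ E H}
  {M : Type*} [TopologicalSpace M] [ChartedSpace H M] {T : Set (Π x : M, TangentSpace I x)}

theorem subset_lieClosure : T ⊆ lieClosure I T :=
  fun _ hX ↦ Submodule.mem_sInf.2 fun _ hL ↦ hL.1 hX

theorem mlieBracket_mem_lieClosure {X Y : Π x : M, TangentSpace I x}
    (hX : X ∈ lieClosure I T) (hY : Y ∈ lieClosure I T) :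
    VectorField.mlieBracket I X Y ∈ lieClosure I T :=
  Submodule.mem_sInf.2 fun L hL ↦ hL.2 X (Submodule.mem_sInf.1 hX L hL) Y
    (Submodule.mem_sInf.1 hY L hL)

theorem lieClosure_le {L : Submodule ℝ (Π x : M, TangentSpace I x)} (hT : T ⊆ L)
    (h : ∀ X ∈ L, ∀ Y ∈ L, VectorField.mlieBracket I X Y ∈ L) : lieClosure I T ≤ L :=
  sInf_le ⟨hT, h⟩

end LieClosure

/-! ### Vector fields on the tangent bundle that lift pairs -/

theorem liftAlong_add (ξ A B A' B' : Π q : Q, TangentSpace 𝓘(ℝ, E) q) (q : Q) :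
    liftAlong ξ (A + A') (B + B') q = liftAlong ξ A B q + liftAlong ξ A' B' q := by
  unfold liftAlong
  rw [Pi.add_apply, Pi.add_apply, map_add, map_add]
  exact add_add_add_comm (G := E × E) _ _ _ _

theorem liftAlong_smul (c : ℝ) (ξ A B : Π q : Q, TangentSpace 𝓘(ℝ, E) q) (q : Q) :
    liftAlong ξ (c • A) (c • B) q = c • liftAlong ξ A B q := by
  unfold liftAlong
  rw [Pi.smul_apply, Pi.smul_apply, map_smul, map_smul]
  exact (smul_add (M := ℝ) (A := E × E) _ _ _).symm

/-- The decomposition of a lift along `ξ` into its horizontal and vertical parts. -/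
theorem liftAlong_eq_horizontalLift_add [FiniteDimensional ℝ E]
    (nabla : CovariantDerivative 𝓘(ℝ, E) E (TangentSpace 𝓘(ℝ, E) : Q → Type _))
    {ξ : Π q : Q, TangentSpace 𝓘(ℝ, E) q} (hξ : IsAnalyticField 𝓘(ℝ, E) ξ)
    (A B : Π q : Q, TangentSpace 𝓘(ℝ, E) q) (q : Q) :
    liftAlong ξ A B q = horizontalLift nabla ⟨q, ξ q⟩ (A q) +
      verticalLift ⟨q, ξ q⟩ (nabla ξ q (A q) + B q) := by
  rw [horizontalLift_eq nabla q ξ (hξ.mdifferentiableAt q), map_add, ← add_assoc, sub_add_cancel]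
  rfl

/-- The vector field `W` on `TQ` lifts the pair `(A, B)`: along every section `ξ ∈ Γ` it is
`Tξ(A ξ) + vlft(B ξ)`. Equivalently, `W` is related, under the evaluation `(q, ξ) ↦ ξ(q)` from
`Q × Γ` to `TQ`, to the vector field on `Q × Γ` with components `(A ξ)(q)` and `B ξ`. The component
`B ξ` has to be in `Γ`, while `A ξ` is an arbitrary analytic vector field. -/
structure IsLift (Γ : Submodule ℝ (Π q : Q, TangentSpace 𝓘(ℝ, E) q))
    (W : Π v : TangentBundle 𝓘(ℝ, E) Q, TangentSpace 𝓘(ℝ, E).tangent v)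
    (A B : (Π q : Q, TangentSpace 𝓘(ℝ, E) q) → Π q : Q, TangentSpace 𝓘(ℝ, E) q) : Prop where
  isAnalyticField : IsAnalyticField 𝓘(ℝ, E).tangent W
  isSmoothMap_fst : IsSmoothMap Γ (analyticFields 𝓘(ℝ, E) Q) A
  isSmoothMap_snd : IsSmoothMap Γ Γ B
  apply_eq : ∀ ξ ∈ Γ, ∀ q, W ⟨q, ξ q⟩ = liftAlong ξ (A ξ) (B ξ) q

variable {W W₁ W₂ : Π v : TangentBundle 𝓘(ℝ, E) Q, TangentSpace 𝓘(ℝ, E).tangent v}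
  {A B A₁ B₁ A₂ B₂ : (Π q : Q, TangentSpace 𝓘(ℝ, E) q) → Π q : Q, TangentSpace 𝓘(ℝ, E) q}

theorem IsLift.congr (h : IsLift Γ W A B) (hA : ∀ ξ ∈ Γ, A ξ = A₁ ξ) (hB : ∀ ξ ∈ Γ, B ξ = B₁ ξ) :
    IsLift Γ W A₁ B₁ where
  isAnalyticField := h.isAnalyticField
  isSmoothMap_fst := h.isSmoothMap_fst.congr hA
  isSmoothMap_snd := h.isSmoothMap_snd.congr hB
  apply_eq ξ hξ q := by rw [h.apply_eq ξ hξ q, hA ξ hξ, hB ξ hξ]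

theorem IsLift.add (h₁ : IsLift Γ W₁ A₁ B₁) (h₂ : IsLift Γ W₂ A₂ B₂) :
    IsLift Γ (W₁ + W₂) (fun ξ ↦ A₁ ξ + A₂ ξ) (fun ξ ↦ B₁ ξ + B₂ ξ) where
  isAnalyticField :=
    (analyticFields 𝓘(ℝ, E).tangent (TangentBundle 𝓘(ℝ, E) Q)).add_mem h₁.isAnalyticField
      h₂.isAnalyticField
  isSmoothMap_fst := h₁.isSmoothMap_fst.add h₂.isSmoothMap_fst
  isSmoothMap_snd := h₁.isSmoothMap_snd.add h₂.isSmoothMap_snd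
  apply_eq ξ hξ q := by
    rw [liftAlong_add, ← h₁.apply_eq ξ hξ, ← h₂.apply_eq ξ hξ]; rfl

theorem IsLift.const_smul (c : ℝ) (h : IsLift Γ W A B) :
    IsLift Γ (c • W) (fun ξ ↦ c • A ξ) (fun ξ ↦ c • B ξ) where
  isAnalyticField :=
    (analyticFields 𝓘(ℝ, E).tangent (TangentBundle 𝓘(ℝ, E) Q)).smul_mem c h.isAnalyticField
  isSmoothMap_fst := h.isSmoothMap_fst.const_smul c
  isSmoothMap_snd := h.isSmoothMap_snd.const_smul c
  apply_eq ξ hξ q := by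
    rw [liftAlong_smul, ← h.apply_eq ξ hξ]; rfl

theorem IsLift.zero : IsLift Γ (0 : Π v : TangentBundle 𝓘(ℝ, E) Q, TangentSpace 𝓘(ℝ, E).tangent v)
    (fun _ ↦ 0) (fun _ ↦ 0) where
  isAnalyticField := (analyticFields 𝓘(ℝ, E).tangent (TangentBundle 𝓘(ℝ, E) Q)).zero_mem
  isSmoothMap_fst := .const (Submodule.zero_mem _)
  isSmoothMap_snd := .const (Submodule.zero_mem _)
  apply_eq ξ hξ q := by
    have := liftAlong_smul 0 ξ 0 0 q
    rw [zero_smul, zero_smul] at this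
    exact this.symm

theorem IsLift.verticalLiftField {X : Π q : Q, TangentSpace 𝓘(ℝ, E) q} (hX : X ∈ Γ)
    (hΓ : Γ ≤ analyticFields 𝓘(ℝ, E) Q) :
    IsLift Γ (verticalLiftField X) (fun _ ↦ 0) (fun _ ↦ X) where
  isAnalyticField := (hΓ hX : IsAnalyticField 𝓘(ℝ, E) X).verticalLiftField
  isSmoothMap_fst := .const (Submodule.zero_mem _)
  isSmoothMap_snd := .const hX
  apply_eq ξ hξ q := by
    unfold liftAlong
    rw [Pi.zero_apply, map_zero]
    exact (zero_add (M := E × E) _).symm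

/-- Lifts are closed under the Lie bracket; the bracket of two lifts lifts the bracket of the
corresponding vector fields on `Q × Γ`. -/
theorem IsLift.mlieBracket [FiniteDimensional ℝ E] (hΓ : Γ ≤ analyticFields 𝓘(ℝ, E) Q)
    (h₁ : IsLift Γ W₁ A₁ B₁) (h₂ : IsLift Γ W₂ A₂ B₂) :
    IsLift Γ (VectorField.mlieBracket 𝓘(ℝ, E).tangent W₁ W₂)
      (fun ξ ↦ VectorField.mlieBracket 𝓘(ℝ, E) (A₁ ξ) (A₂ ξ) + fieldDeriv A₂ ξ (B₁ ξ) -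
        fieldDeriv A₁ ξ (B₂ ξ))
      (fun ξ ↦ fieldDeriv B₂ ξ (B₁ ξ) - fieldDeriv B₁ ξ (B₂ ξ)) where
  isAnalyticField := h₁.isAnalyticField.mlieBracket h₂.isAnalyticField
  isSmoothMap_fst := by
    refine (IsSmoothMap.add ?_ (h₂.isSmoothMap_fst.fieldDeriv h₁.isSmoothMap_snd)).sub
      (h₁.isSmoothMap_fst.fieldDeriv h₂.isSmoothMap_snd)
    refine .bilinear (m := VectorField.mlieBracket 𝓘(ℝ, E))
      (fun X hX Y hY ↦ IsAnalyticField.mlieBracket hX hY) (fun X hX X' hX' Y _ ↦ ?_)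
      (fun X _ Y hY Y' hY' ↦ ?_) (fun c X hX Y _ ↦ ?_) (fun c X _ Y hY ↦ ?_)
      h₁.isSmoothMap_fst h₂.isSmoothMap_fst
    all_goals funext q
    · exact VectorField.mlieBracket_add_left (IsAnalyticField.mdifferentiableAt hX q)
        (IsAnalyticField.mdifferentiableAt hX' q)
    · exact VectorField.mlieBracket_add_right (IsAnalyticField.mdifferentiableAt hY q)
        (IsAnalyticField.mdifferentiableAt hY' q)
    · exact VectorField.mlieBracket_const_smul_left (IsAnalyticField.mdifferentiableAt hX q)
    · exact VectorField.mlieBracket_const_smul_right (IsAnalyticField.mdifferentiableAt hY q)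
  isSmoothMap_snd := (h₂.isSmoothMap_snd.fieldDeriv h₁.isSmoothMap_snd).sub
    (h₁.isSmoothMap_snd.fieldDeriv h₂.isSmoothMap_snd)
  apply_eq ξ hξ q := by
    have hB₁ := h₁.isSmoothMap_snd.mem hξ
    have hB₂ := h₂.isSmoothMap_snd.mem hξ
    have hmem {η} (hη : η ∈ Γ) (t : ℝ) : ξ + t • η ∈ Γ := Γ.add_mem hξ (Γ.smul_mem t hη)
    refine mlieBracket_liftAlong h₁.isAnalyticField h₂.isAnalyticField (hΓ hξ)
      (h₁.isSmoothMap_fst.mem hξ) (hΓ hB₁) (h₂.isSmoothMap_fst.mem hξ) (hΓ hB₂)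
      (h₁.apply_eq ξ hξ) (h₂.apply_eq ξ hξ)
      (α₁ := fun t ↦ A₁ (ξ + t • B₂ ξ)) (β₁ := fun t ↦ B₁ (ξ + t • B₂ ξ))
      (α₂ := fun t ↦ A₂ (ξ + t • B₁ ξ)) (β₂ := fun t ↦ B₂ (ξ + t • B₁ ξ))
      (fun t ↦ h₁.apply_eq _ (hmem hB₂ t) q) (fun t ↦ h₂.apply_eq _ (hmem hB₁ t) q)
      (h₁.isSmoothMap_fst.hasDerivAt_fieldDeriv hξ hB₂ q)
      (h₁.isSmoothMap_snd.hasDerivAt_fieldDeriv hξ hB₂ q)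
      (h₂.isSmoothMap_fst.hasDerivAt_fieldDeriv hξ hB₁ q)
      (h₂.isSmoothMap_snd.hasDerivAt_fieldDeriv hξ hB₁ q)
      (by simp) (by simp) rfl rfl

end Lifts

section Algebra

variable {E : Type*} [NormedAddCommGroup E] [NormedSpace ℝ E]
  {Q : Type*} [TopologicalSpace Q] [ChartedSpace E Q] [IsManifold 𝓘(ℝ, E) ω Q]
  {nabla : CovariantDerivative 𝓘(ℝ, E) E (TangentSpace 𝓘(ℝ, E) : Q → Type _)}
  {Γ : Submodule ℝ (Π q : Q, TangentSpace 𝓘(ℝ, E) q)}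
  {S : Set (Π q : Q, TangentSpace 𝓘(ℝ, E) q)}

/-! ### The symmetric product as a smooth map -/

theorem symProduct_comm (nabla : CovariantDerivative 𝓘(ℝ, E) E (TangentSpace 𝓘(ℝ, E) : Q → Type _))
    (X Y : Π q : Q, TangentSpace 𝓘(ℝ, E) q) : symProduct nabla X Y = symProduct nabla Y X :=
  funext fun _ ↦ add_comm _ _

theorem symProduct_add_left {X X' : Π q : Q, TangentSpace 𝓘(ℝ, E) q}
    (nabla : CovariantDerivative 𝓘(ℝ, E) E (TangentSpace 𝓘(ℝ, E) : Q → Type _))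
    (hX : IsAnalyticField 𝓘(ℝ, E) X) (hX' : IsAnalyticField 𝓘(ℝ, E) X')
    (Y : Π q : Q, TangentSpace 𝓘(ℝ, E) q) :
    symProduct nabla (X + X') Y = symProduct nabla X Y + symProduct nabla X' Y := by
  funext q
  have h := congrArg (fun L : TangentSpace 𝓘(ℝ, E) q →L[ℝ] TangentSpace 𝓘(ℝ, E) q ↦ L (Y q))
    (nabla.isCovariantDerivativeOnUniv.add (hX.mdifferentiableAt q) (hX'.mdifferentiableAt q))
  change nabla Y q (X q + X' q) + nabla (X + X') q (Y q) =
    nabla Y q (X q) + nabla X q (Y q) + (nabla Y q (X' q) + nabla X' q (Y q))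
  rw [map_add, add_add_add_comm]
  exact congrArg (_ + ·) h

theorem symProduct_smul_left {X : Π q : Q, TangentSpace 𝓘(ℝ, E) q} (c : ℝ)
    (nabla : CovariantDerivative 𝓘(ℝ, E) E (TangentSpace 𝓘(ℝ, E) : Q → Type _))
    (hX : IsAnalyticField 𝓘(ℝ, E) X) (Y : Π q : Q, TangentSpace 𝓘(ℝ, E) q) :
    symProduct nabla (c • X) Y = c • symProduct nabla X Y := by
  funext q
  have h := congrArg (fun L : TangentSpace 𝓘(ℝ, E) q →L[ℝ] TangentSpace 𝓘(ℝ, E) q ↦ L (Y q))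
    (nabla.isCovariantDerivativeOnUniv.smul_const (a := c) (hX.mdifferentiableAt q))
  change nabla Y q (c • X q) + nabla (c • X) q (Y q) = c • (nabla Y q (X q) + nabla X q (Y q))
  rw [map_smul, smul_add]
  exact congrArg (_ + ·) h

theorem symProduct_add_smul {ξ η : Π q : Q, TangentSpace 𝓘(ℝ, E) q}
    (nabla : CovariantDerivative 𝓘(ℝ, E) E (TangentSpace 𝓘(ℝ, E) : Q → Type _))
    (hξ : IsAnalyticField 𝓘(ℝ, E) ξ) (hη : IsAnalyticField 𝓘(ℝ, E) η) (t : ℝ)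
    (Y : Π q : Q, TangentSpace 𝓘(ℝ, E) q) :
    symProduct nabla (ξ + t • η) Y = symProduct nabla ξ Y + t • symProduct nabla η Y := by
  rw [symProduct_add_left nabla hξ ((analyticFields 𝓘(ℝ, E) Q).smul_mem t hη),
    symProduct_smul_left t nabla hη]

theorem fieldDeriv_symProduct_left {ξ η : Π q : Q, TangentSpace 𝓘(ℝ, E) q}
    (hξ : IsAnalyticField 𝓘(ℝ, E) ξ) (hη : IsAnalyticField 𝓘(ℝ, E) η)
    (X : Π q : Q, TangentSpace 𝓘(ℝ, E) q) :
    fieldDeriv (fun ξ ↦ symProduct nabla ξ X) ξ η = symProduct nabla η X :=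
  fieldDeriv_eq_of_forall (X := symProduct nabla ξ X) (Z := 0) fun t ↦ by
    rw [symProduct_add_smul nabla hξ hη, smul_zero, add_zero]

/-- The derivative of `ξ ↦ -∇_ξ ξ`, written with the symmetric product. -/
theorem fieldDeriv_symProduct_self {ξ η : Π q : Q, TangentSpace 𝓘(ℝ, E) q}
    (hξ : IsAnalyticField 𝓘(ℝ, E) ξ) (hη : IsAnalyticField 𝓘(ℝ, E) η) :
    fieldDeriv (fun ξ ↦ -(2⁻¹ : ℝ) • symProduct nabla ξ ξ) ξ η = -symProduct nabla ξ η :=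
  fieldDeriv_eq_of_forall (X := -(2⁻¹ : ℝ) • symProduct nabla ξ ξ)
    (Z := -(2⁻¹ : ℝ) • symProduct nabla η η) fun t ↦ by
    rw [symProduct_add_smul nabla hξ hη, symProduct_comm nabla ξ (ξ + t • η),
      symProduct_comm nabla η (ξ + t • η), symProduct_add_smul nabla hξ hη,
      symProduct_add_smul nabla hξ hη, symProduct_comm nabla η ξ]
    module

/-- The symmetric product with analytic arguments in a space closed under it preserves smooth
maps. -/
theorem IsSmoothMap.symProduct {A B : (Π q : Q, TangentSpace 𝓘(ℝ, E) q) →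
      Π q : Q, TangentSpace 𝓘(ℝ, E) q} (hΓ : Γ ≤ analyticFields 𝓘(ℝ, E) Q)
    (hsym : ∀ X ∈ Γ, ∀ Y ∈ Γ, symProduct nabla X Y ∈ Γ)
    (hA : IsSmoothMap Γ Γ A) (hB : IsSmoothMap Γ Γ B) :
    IsSmoothMap Γ Γ fun ξ ↦ symProduct nabla (A ξ) (B ξ) := by
  refine .bilinear hsym (fun X hX X' hX' Y _ ↦ symProduct_add_left nabla (hΓ hX) (hΓ hX') Y)
    (fun X _ Y hY Y' hY' ↦ ?_) (fun c X hX Y _ ↦ symProduct_smul_left c nabla (hΓ hX) Y)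
    (fun c X _ Y hY ↦ ?_) hA hB
  · simp only [symProduct_comm nabla X]
    exact symProduct_add_left nabla (hΓ hY) (hΓ hY') X
  · simp only [symProduct_comm nabla X]
    exact symProduct_smul_left c nabla (hΓ hY) X

theorem verticalLift_injective (v : TangentBundle 𝓘(ℝ, E) Q) :
    Function.Injective (verticalLift v) := fun u u' h ↦ by
  rw [verticalLift_apply, verticalLift_apply] at h
  exact congrArg (Prod.snd : E × E → E) h

/-! ### The Lie algebra of the spray and the vertical lifts -/

variable {W W₁ W₂ : Π v : TangentBundle 𝓘(ℝ, E) Q, TangentSpace 𝓘(ℝ, E).tangent v}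
  {A B : (Π q : Q, TangentSpace 𝓘(ℝ, E) q) → Π q : Q, TangentSpace 𝓘(ℝ, E) q}
  {X X₁ X₂ : Π q : Q, TangentSpace 𝓘(ℝ, E) q}
  [FiniteDimensional ℝ E]

/-- The geodesic spray lifts `(ξ, -∇_ξ ξ)`, and `∇_ξ ξ = ½ ⟨ξ : ξ⟩` is in `Γ`. -/
theorem IsLift.geodesicSpray (hnabla : IsAnalyticConnection nabla)
    (hΓ : Γ ≤ analyticFields 𝓘(ℝ, E) Q)
    (hsym : ∀ X ∈ Γ, ∀ Y ∈ Γ, symProduct nabla X Y ∈ Γ) :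
    IsLift Γ (geodesicSpray nabla) (fun ξ ↦ ξ) (fun ξ ↦ -(2⁻¹ : ℝ) • symProduct nabla ξ ξ) where
  isAnalyticField := hnabla.isAnalyticField_geodesicSpray
  isSmoothMap_fst := .id hΓ
  isSmoothMap_snd := ((IsSmoothMap.id le_rfl).symProduct hΓ hsym (.id le_rfl)).const_smul _
  apply_eq ξ hξ q := by
    rw [geodesicSpray_section nabla ((hΓ hξ : IsAnalyticField 𝓘(ℝ, E) ξ).mdifferentiableAt q)]
    congr 1
    funext q
    change _ = -(2⁻¹ : ℝ) • (nabla ξ q (ξ q) + nabla ξ q (ξ q))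
    rw [← two_smul ℝ, smul_smul]
    norm_num

/-- `[Z, X^V]` lifts `(-X, ⟨ξ : X⟩)`. -/
theorem IsLift.mlieBracket_geodesicSpray (hnabla : IsAnalyticConnection nabla)
    (hΓ : Γ ≤ analyticFields 𝓘(ℝ, E) Q)
    (hsym : ∀ X ∈ Γ, ∀ Y ∈ Γ, symProduct nabla X Y ∈ Γ) (hX : X ∈ Γ)
    (h : IsLift Γ W (fun _ ↦ 0) (fun _ ↦ X)) :
    IsLift Γ (VectorField.mlieBracket 𝓘(ℝ, E).tangent (AffineControl.geodesicSpray nabla) W)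
      (fun _ ↦ -X) (fun ξ ↦ symProduct nabla ξ X) := by
  refine ((IsLift.geodesicSpray hnabla hΓ hsym).mlieBracket hΓ h).congr (fun ξ hξ ↦ ?_)
    (fun ξ hξ ↦ ?_)
  · rw [fieldDeriv_const, fieldDeriv_id, VectorField.mlieBracket_zero_right, add_zero, zero_sub]
  · rw [fieldDeriv_const, fieldDeriv_symProduct_self (hΓ hξ) (hΓ hX), zero_sub, neg_neg]

/-- The symmetric product is an iterated bracket with the spray: `[X₁^V, [Z, X₂^V]]` is
`⟨X₁ : X₂⟩^V` along the sections in `Γ`. -/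
theorem IsLift.mlieBracket_mlieBracket_geodesicSpray (hnabla : IsAnalyticConnection nabla)
    (hΓ : Γ ≤ analyticFields 𝓘(ℝ, E) Q)
    (hsym : ∀ X ∈ Γ, ∀ Y ∈ Γ, symProduct nabla X Y ∈ Γ) (hX₁ : X₁ ∈ Γ) (hX₂ : X₂ ∈ Γ)
    (h₁ : IsLift Γ W₁ (fun _ ↦ 0) (fun _ ↦ X₁)) (h₂ : IsLift Γ W₂ (fun _ ↦ 0) (fun _ ↦ X₂)) :
    IsLift Γ (VectorField.mlieBracket 𝓘(ℝ, E).tangent W₁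
        (VectorField.mlieBracket 𝓘(ℝ, E).tangent (AffineControl.geodesicSpray nabla) W₂))
      (fun _ ↦ 0) (fun _ ↦ symProduct nabla X₁ X₂) := by
  refine (h₁.mlieBracket hΓ (h₂.mlieBracket_geodesicSpray hnabla hΓ hsym hX₂)).congr
    (fun ξ hξ ↦ ?_) (fun ξ hξ ↦ ?_)
  · rw [fieldDeriv_const, fieldDeriv_const, VectorField.mlieBracket_zero_left, add_zero, sub_zero]
  · rw [fieldDeriv_const, fieldDeriv_symProduct_left (hΓ hξ) (hΓ hX₁), sub_zero]

/-- Every member of `Lie^(∞)(Z, S^V)` is a lift over `Γ = Sym^(∞)(S)`. This bounds the vertical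
vectors in `Lie^(∞)(Z, S^V)` from above. -/
theorem exists_isLift_of_mem_accessibilityAlgebra (hnabla : IsAnalyticConnection nabla)
    (hS : S ⊆ analyticFields 𝓘(ℝ, E) Q) (hW : W ∈ accessibilityAlgebra nabla S) :
    ∃ A B, IsLift (symClosure nabla S) W A B := by
  have hΓ := hnabla.symClosure_le_analyticFields hS
  let L : Submodule ℝ (Π v : TangentBundle 𝓘(ℝ, E) Q, TangentSpace 𝓘(ℝ, E).tangent v) :=
    { carrier := {W | ∃ A B, IsLift (symClosure nabla S) W A B}
      add_mem' := fun ⟨_, _, h⟩ ⟨_, _, h'⟩ ↦ ⟨_, _, h.add h'⟩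
      zero_mem' := ⟨_, _, .zero⟩
      smul_mem' := fun c _ ⟨_, _, h⟩ ↦ ⟨_, _, h.const_smul c⟩ }
  refine lieClosure_le (L := L) (Set.insert_subset ?_ ?_)
    (fun _ ⟨_, _, h⟩ _ ⟨_, _, h'⟩ ↦ ⟨_, _, h.mlieBracket hΓ h'⟩) hW
  · exact ⟨_, _, .geodesicSpray hnabla hΓ fun _ hX _ hY ↦ symProduct_mem_symClosure hX hY⟩
  · rintro _ ⟨X, hX, rfl⟩
    exact ⟨_, _, .verticalLiftField (subset_symClosure hX) hΓ⟩

/-- The lifts of the pairs `(0, X)` with `X ∈ Sym^(∞)(S)` are in `Lie^(∞)(Z, S^V)`. This bounds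
the vertical vectors in `Lie^(∞)(Z, S^V)` from below. -/
theorem exists_isLift_zero_of_mem_symClosure (hnabla : IsAnalyticConnection nabla)
    (hS : S ⊆ analyticFields 𝓘(ℝ, E) Q) (hX : X ∈ symClosure nabla S) :
    ∃ W ∈ accessibilityAlgebra nabla S, IsLift (symClosure nabla S) W (fun _ ↦ 0) (fun _ ↦ X) := by
  have hΓ := hnabla.symClosure_le_analyticFields hS
  let L : Submodule ℝ (Π q : Q, TangentSpace 𝓘(ℝ, E) q) :=
    { carrier := {X | X ∈ symClosure nabla S ∧ ∃ W ∈ accessibilityAlgebra nabla S,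
        IsLift (symClosure nabla S) W (fun _ ↦ 0) (fun _ ↦ X)}
      add_mem' := fun ⟨hX, W, hW, h⟩ ⟨hX', W', hW', h'⟩ ↦ ⟨add_mem hX hX', W + W',
        add_mem hW hW', (h.add h').congr (fun _ _ ↦ add_zero 0) fun _ _ ↦ rfl⟩
      zero_mem' := ⟨zero_mem _, 0, zero_mem _, .zero⟩
      smul_mem' := fun c _ ⟨hX, W, hW, h⟩ ↦ ⟨Submodule.smul_mem _ c hX, c • W,
        Submodule.smul_mem _ c hW, (h.const_smul c).congr (fun _ _ ↦ smul_zero c) fun _ _ ↦ rfl⟩ }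
  refine (symClosure_le (Γ := L) ?_ ?_ hX).2
  · intro X hX
    exact ⟨subset_symClosure hX, _, subset_lieClosure (.inr ⟨X, hX, rfl⟩),
      .verticalLiftField (subset_symClosure hX) hΓ⟩
  · rintro X₁ ⟨hX₁, W₁, hW₁, h₁⟩ X₂ ⟨hX₂, W₂, hW₂, h₂⟩
    exact ⟨symProduct_mem_symClosure hX₁ hX₂, _, mlieBracket_mem_lieClosure hW₁
      (mlieBracket_mem_lieClosure (subset_lieClosure (.inl rfl)) hW₂),
      h₁.mlieBracket_mlieBracket_geodesicSpray hnabla hΓ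
        (fun _ hX _ hY ↦ symProduct_mem_symClosure hX hY) hX₁ hX₂ h₂⟩

/-- Every `X` in the involutive closure of `Sym^(∞)(S)` is the first component of a lift in
`Lie^(∞)(Z, S^V)`: for `X ∈ Sym^(∞)(S)` it is that of `-[Z, X^V]`, and pairs whose first component
does not depend on `ξ` have as first component of their bracket the bracket on `Q`. -/
theorem exists_isLift_of_mem_lieClosure_symClosure (hnabla : IsAnalyticConnection nabla)
    (hS : S ⊆ analyticFields 𝓘(ℝ, E) Q)
    (hX : X ∈ lieClosure 𝓘(ℝ, E) (symClosure nabla S : Set (Π q : Q, TangentSpace 𝓘(ℝ, E) q))) :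
    ∃ W ∈ accessibilityAlgebra nabla S, ∃ B, IsLift (symClosure nabla S) W (fun _ ↦ X) B := by
  have hΓ := hnabla.symClosure_le_analyticFields hS
  let L : Submodule ℝ (Π q : Q, TangentSpace 𝓘(ℝ, E) q) :=
    { carrier := {X | ∃ W ∈ accessibilityAlgebra nabla S, ∃ B,
        IsLift (symClosure nabla S) W (fun _ ↦ X) B}
      add_mem' := fun ⟨_, hW, _, h⟩ ⟨_, hW', _, h'⟩ ↦ ⟨_, add_mem hW hW', _, h.add h'⟩
      zero_mem' := ⟨0, zero_mem _, _, .zero⟩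
      smul_mem' := fun c _ ⟨_, hW, _, h⟩ ↦
        ⟨_, Submodule.smul_mem _ c hW, _, h.const_smul c⟩ }
  refine lieClosure_le (L := L) (fun X hX ↦ ?_) ?_ hX
  · obtain ⟨W, hW, h⟩ := exists_isLift_zero_of_mem_symClosure hnabla hS hX
    refine ⟨_, Submodule.smul_mem _ (-1) (mlieBracket_mem_lieClosure
      (subset_lieClosure (.inl rfl)) hW), _, ((h.mlieBracket_geodesicSpray hnabla hΓ
        (fun _ hX _ hY ↦ symProduct_mem_symClosure hX hY) hX).const_smul (-1)).congr
      (fun _ _ ↦ by rw [neg_smul, one_smul, neg_neg]) fun _ _ ↦ rfl⟩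
  · rintro X₁ ⟨W₁, hW₁, B₁, h₁⟩ X₂ ⟨W₂, hW₂, B₂, h₂⟩
    exact ⟨_, mlieBracket_mem_lieClosure hW₁ hW₂, _, (h₁.mlieBracket hΓ h₂).congr
      (fun _ _ ↦ by rw [fieldDeriv_const, fieldDeriv_const, add_zero, sub_zero]) fun _ _ ↦ rfl⟩

/-! ### Values along the distribution -/

theorem IsLift.tangentProj_apply (hΓ : Γ ≤ analyticFields 𝓘(ℝ, E) Q)
    (nabla : CovariantDerivative 𝓘(ℝ, E) E (TangentSpace 𝓘(ℝ, E) : Q → Type _))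
    (h : IsLift Γ W A B) {ξ : Π q : Q, TangentSpace 𝓘(ℝ, E) q} (hξ : ξ ∈ Γ) (q : Q) :
    tangentProj ⟨q, ξ q⟩ (W ⟨q, ξ q⟩) = A ξ q := by
  rw [h.apply_eq ξ hξ, liftAlong_eq_horizontalLift_add nabla (hΓ hξ), map_add,
    tangentProj_horizontalLift, tangentProj_verticalLift, add_zero]

theorem verticalLift_mem_valuesAt_accessibilityAlgebra (hnabla : IsAnalyticConnection nabla)
    (hS : S ⊆ analyticFields 𝓘(ℝ, E) Q) (v : TangentBundle 𝓘(ℝ, E) Q)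
    (hv : v.2 ∈ valuesAt (symClosure nabla S) v.1) {u : TangentSpace 𝓘(ℝ, E) v.1}
    (hu : u ∈ valuesAt (symClosure nabla S) v.1) :
    verticalLift v u ∈ valuesAt (accessibilityAlgebra nabla S) v := by
  obtain ⟨q, w⟩ := v
  obtain ⟨ξ, hξ, rfl : ξ q = w⟩ := hv
  obtain ⟨X, hX, rfl : X q = u⟩ := hu
  obtain ⟨W, hW, h⟩ := exists_isLift_zero_of_mem_symClosure hnabla hS hX
  refine ⟨W, hW, ?_⟩
  have h' := IsLift.verticalLiftField hX (hnabla.symClosure_le_analyticFields hS)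
  exact (h.apply_eq ξ hξ q).trans (h'.apply_eq ξ hξ q).symm

theorem exists_verticalLift_eq_of_mem (hnabla : IsAnalyticConnection nabla)
    (hS : S ⊆ analyticFields 𝓘(ℝ, E) Q) (v : TangentBundle 𝓘(ℝ, E) Q)
    (hv : v.2 ∈ valuesAt (symClosure nabla S) v.1) {z : TangentSpace 𝓘(ℝ, E).tangent v}
    (hz : z ∈ valuesAt (accessibilityAlgebra nabla S) v) (hz' : z ∈ verticalSpace v) :
    ∃ u ∈ valuesAt (symClosure nabla S) v.1, verticalLift v u = z := by
  obtain ⟨q, w⟩ := v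
  obtain ⟨ξ, hξ, rfl : ξ q = w⟩ := hv
  obtain ⟨W, hW, rfl : W ⟨q, ξ q⟩ = z⟩ := hz
  obtain ⟨A, B, h⟩ := exists_isLift_of_mem_accessibilityAlgebra hnabla hS hW
  have hΓ := hnabla.symClosure_le_analyticFields hS
  have hA : A ξ q = 0 := (h.tangentProj_apply hΓ nabla hξ q).symm.trans hz'
  refine ⟨B ξ q, ⟨B ξ, h.isSmoothMap_snd.mem hξ, rfl⟩, ?_⟩
  rw [h.apply_eq ξ hξ, liftAlong_eq_horizontalLift_add nabla (hΓ hξ), hA, map_zero, map_zero]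
  dsimp only
  rw [zero_add]
  exact congrArg (verticalLift _) (zero_add (B ξ q)).symm

/-- If `W ∈ Lie^(∞)(Z, S^V)` lifts `(X, B)`, then `W(ξ(q))` is `hlft(X(q))` plus the vertical lift
of `∇_X ξ + B ξ` at `q`. Since `∇` restricts to the distribution, that vertical lift is itself a
value of `Lie^(∞)(Z, S^V)` and can be subtracted. -/
theorem horizontalLift_mem_valuesAt_accessibilityAlgebra (hnabla : IsAnalyticConnection nabla)
    (hS : S ⊆ analyticFields 𝓘(ℝ, E) Q)
    (hres : RestrictsTo nabla (valuesAt (symClosure nabla S))) (v : TangentBundle 𝓘(ℝ, E) Q)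
    (hv : v.2 ∈ valuesAt (symClosure nabla S) v.1) {u : TangentSpace 𝓘(ℝ, E) v.1}
    (hu : u ∈ valuesAt (lieClosure 𝓘(ℝ, E)
      (symClosure nabla S : Set (Π q : Q, TangentSpace 𝓘(ℝ, E) q))) v.1) :
    horizontalLift nabla v u ∈ valuesAt (accessibilityAlgebra nabla S) v := by
  have hvert := fun {u} ↦ verticalLift_mem_valuesAt_accessibilityAlgebra hnabla hS v hv (u := u)
  obtain ⟨q, w⟩ := v
  obtain ⟨ξ, hξ, rfl : ξ q = w⟩ := hv
  obtain ⟨X, hX, rfl : X q = u⟩ := hu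
  obtain ⟨W, hW, B, h⟩ := exists_isLift_of_mem_lieClosure_symClosure hnabla hS hX
  have hΓ := hnabla.symClosure_le_analyticFields hS
  have hD : nabla ξ q (X q) + B ξ q ∈ valuesAt (symClosure nabla S) q :=
    add_mem (hres X ξ (h.isSmoothMap_fst.mem hξ) (hΓ hξ) (fun p ↦ ⟨ξ, hξ, rfl⟩) q)
      ⟨B ξ, h.isSmoothMap_snd.mem hξ, rfl⟩
  have hW' : W ⟨q, ξ q⟩ = horizontalLift nabla ⟨q, ξ q⟩ (X q) +
      verticalLift ⟨q, ξ q⟩ (nabla ξ q (X q) + B ξ q) := by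
    rw [h.apply_eq ξ hξ, liftAlong_eq_horizontalLift_add nabla (hΓ hξ)]
  have hWv : W ⟨q, ξ q⟩ ∈ valuesAt (accessibilityAlgebra nabla S) ⟨q, ξ q⟩ := ⟨W, hW, rfl⟩
  rw [hW'] at hWv
  exact (Submodule.add_mem_iff_left _ (hvert hD)).1 hWv

end Algebra

end AffineControl

end

theorem mainTheorem3 {E : Type*} [NormedAddCommGroup E] [NormedSpace ℝ E] [FiniteDimensional ℝ E]
    {Q : Type*} [TopologicalSpace Q] [T2Space Q] [ParacompactSpace Q]
    [ChartedSpace E Q] [IsManifold 𝓘(ℝ, E) ω Q]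
    (nabla : CovariantDerivative 𝓘(ℝ, E) E (TangentSpace 𝓘(ℝ, E) : Q → Type _))
    (hnabla : AffineControl.IsAnalyticConnection nabla)
    {r : ℕ} (Y : Fin r → Π q : Q, TangentSpace 𝓘(ℝ, E) q)
    (hY : ∀ a, AffineControl.IsAnalyticField 𝓘(ℝ, E) (Y a))
    (hres : AffineControl.RestrictsTo nabla
      (AffineControl.valuesAt (AffineControl.symClosure nabla (Set.range Y))))
    (v : TangentBundle 𝓘(ℝ, E) Q)
    (hv : v.2 ∈ AffineControl.valuesAt (AffineControl.symClosure nabla (Set.range Y)) v.1) :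
    (∃ e : AffineControl.valuesAt (AffineControl.symClosure nabla (Set.range Y)) v.1 ≃ₗ[ℝ]
        ↥(AffineControl.valuesAt (AffineControl.accessibilityAlgebra nabla (Set.range Y)) v ⊓
          AffineControl.verticalSpace v),
      ∀ u, (e u : TangentSpace 𝓘(ℝ, E).tangent v) = AffineControl.verticalLift v u) ∧
    (∀ u ∈ AffineControl.valuesAt (AffineControl.lieClosure 𝓘(ℝ, E)
        (AffineControl.symClosure nabla (Set.range Y) :
          Set (Π q : Q, TangentSpace 𝓘(ℝ, E) q))) v.1,
      AffineControl.horizontalLift nabla v u ∈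
        AffineControl.valuesAt (AffineControl.accessibilityAlgebra nabla (Set.range Y)) v ⊓
          AffineControl.horizontalSpace nabla v) := by
  have hS : Set.range Y ⊆ AffineControl.analyticFields 𝓘(ℝ, E) Q := Set.range_subset_iff.2 hY
  refine ⟨?_, fun u hu ↦
    ⟨AffineControl.horizontalLift_mem_valuesAt_accessibilityAlgebra hnabla hS hres v hv hu, u,
      rfl⟩⟩
  let f := ((AffineControl.verticalLift v).toLinearMap.domRestrict
      (AffineControl.valuesAt (AffineControl.symClosure nabla (Set.range Y)) v.1)).codRestrict
    (AffineControl.valuesAt (AffineControl.accessibilityAlgebra nabla (Set.range Y)) v ⊓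
      AffineControl.verticalSpace v) fun u ↦
      ⟨AffineControl.verticalLift_mem_valuesAt_accessibilityAlgebra hnabla hS v hv u.2,
        AffineControl.tangentProj_verticalLift v u⟩
  refine ⟨LinearEquiv.ofBijective f ⟨fun u u' h ↦ ?_, fun ⟨z, hz, hz'⟩ ↦ ?_⟩, fun u ↦ rfl⟩
  · exact Subtype.ext (AffineControl.verticalLift_injective v (congrArg Subtype.val h))
  · obtain ⟨u, hu, rfl⟩ := AffineControl.exists_verticalLift_eq_of_mem hnabla hS v hv hz hz'
    exact ⟨⟨u, hu⟩, rfl⟩
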